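/- Let $X$ be a smooth projective variety over $\mathbb{C}$ (an integral scheme, smooth over $\mathbb{C}$, that is isomorphic to a closed subscheme of some $\mathbb{P}^n_{\mathbb{C}}$). Let $D_0, D_1\subset X$ be smooth hypersurfaces, that is, effective Cartier divisors which are smooth over $\mathbb{C}$ as schemes (they need not be connected), and suppose that they are linearly equivalent: $D_0-D_1=\operatorname{div}(f)$ for some nonzero rational function $f$ on $X$. Let $Z$ be a smooth closed subvariety of $X$ (not necessarily connected) contained in $D_0\cap D_1$. Then for every $i\in\mathbb{Z}$ the restriction maps $$H^i(D_0,\mathbb{Q})\to H^i(Z,\mathbb{Q})\quad\text{and}\quad H^i(D_1,\mathbb{Q})\to H^i(Z,\mathbb{Q})$$ have the same image, where $H^i(\,\cdot\,,\mathbb{Q})$ denotes the singular cohomology with rational coefficients of the set of complex points with the classical topology (zero for $i<0$). -/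

import Mathlib

open CategoryTheory AlgebraicGeometry Opposite

noncomputable section

namespace ComplexVariety

/-! ### Singular cohomology with rational coefficients -/

/-- The rational singular cochain complex `Hom(C_•(T; ℚ), ℚ)`, contravariantly in the space `T`.
Its shape `(ComplexShape.down ℕ).symm` has differentials from degree `i` to degree `i + 1`. -/
def singularCochainFunctor :
    TopCat.{0}ᵒᵖ ⥤ HomologicalComplex (ModuleCat.{0} ℚ) (ComplexShape.down ℕ).symm :=
  ((AlgebraicTopology.singularChainComplexFunctor (ModuleCat.{0} ℚ)).obj (ModuleCat.of ℚ ℚ)).op ⋙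
    HomologicalComplex.opFunctor (ModuleCat.{0} ℚ) (ComplexShape.down ℕ) ⋙
    ((linearYoneda ℚ (ModuleCat.{0} ℚ)).obj (ModuleCat.of ℚ ℚ)).mapHomologicalComplex _

/-- The functor `T ↦ H^i(T, ℚ)` for every integer `i`; it is zero for `i < 0`. -/
def singularCohomologyFunctor : ℤ → (TopCat.{0}ᵒᵖ ⥤ ModuleCat.{0} ℚ)
  | .ofNat i => singularCochainFunctor ⋙ HomologicalComplex.homologyFunctor _ _ i
  | .negSucc _ => (Functor.const _).obj (ModuleCat.of ℚ PUnit)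

/-! ### Complex points with the classical topology -/

/-- The spectrum of the field of complex numbers. -/
abbrev SpecC : Scheme.{0} := Spec (CommRingCat.of ℂ)

/-- The set `X(ℂ)` of complex points of a scheme `X` over `ℂ`. -/
def Points (X : Over SpecC) : Type := Over.mk (𝟙 SpecC) ⟶ X

/-- The value `f(x) ∈ ℂ` at a complex point `x` of a regular function `f` on an open `U ∋ x`. -/
def Points.eval {X : Over SpecC} (x : Points X) {U : X.left.Opens}
    (h : ⊤ ≤ x.left ⁻¹ᵁ U) (f : Γ(X.left, U)) : ℂ :=
  (Scheme.ΓSpecIso (CommRingCat.of ℂ)).hom (x.left.appLE U ⊤ h f)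

/-- The set of complex points of `U` at which the regular function `f` on `U` has its value
in `V`. -/
def Points.basicSet {X : Over SpecC} (U : X.left.Opens) (f : Γ(X.left, U)) (V : Set ℂ) :
    Set (Points X) :=
  {x | ∃ h : ⊤ ≤ x.left ⁻¹ᵁ U, x.eval h f ∈ V}

/-- The classical (analytic) topology on `X(ℂ)`: the coarsest one for which `U(ℂ)` is open and
all regular functions `U(ℂ) → ℂ` are continuous, for all Zariski open `U ⊆ X`. -/
instance (X : Over SpecC) : TopologicalSpace (Points X) :=
  TopologicalSpace.generateFrom
    {s | ∃ (U : X.left.Opens) (f : Γ(X.left, U)) (V : Set ℂ),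
      IsOpen V ∧ s = Points.basicSet U f V}

/-- The map `X(ℂ) → Y(ℂ)` induced by a morphism `X ⟶ Y` over `ℂ`. -/
def Points.map {X Y : Over SpecC} (g : X ⟶ Y) (x : Points X) : Points Y :=
  CategoryStruct.comp (obj := Over SpecC) x g

lemma Points.continuous_map {X Y : Over SpecC} (g : X ⟶ Y) : Continuous (Points.map g) := by
  refine continuous_generateFrom_iff.2 ?_
  rintro _ ⟨U, f, V, hV, rfl⟩
  refine TopologicalSpace.isOpen_generateFrom_of_mem
    ⟨g.left ⁻¹ᵁ U, g.left.app U f, V, hV, ?_⟩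
  ext x
  have key : ∀ (h : ⊤ ≤ (Points.map g x).left ⁻¹ᵁ U) (h' : ⊤ ≤ x.left ⁻¹ᵁ (g.left ⁻¹ᵁ U)),
      (Points.map g x).eval h f = x.eval h' (g.left.app U f) := by
    intro h h'
    have e : g.left.app U ≫ x.left.appLE (g.left ⁻¹ᵁ U) ⊤ h' =
        (x.left ≫ g.left).appLE U ⊤ h' := by
      simp [Scheme.Hom.appLE]
    change (Scheme.ΓSpecIso (CommRingCat.of ℂ)).hom ((x.left ≫ g.left).appLE U ⊤ h f) =
      (Scheme.ΓSpecIso (CommRingCat.of ℂ)).hom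
        (x.left.appLE (g.left ⁻¹ᵁ U) ⊤ h' (g.left.app U f))
    rw [← e]
    rfl
  exact ⟨fun ⟨h, hf⟩ => ⟨h, key h h ▸ hf⟩, fun ⟨h, hf⟩ => ⟨h, (key h h).symm ▸ hf⟩⟩

/-- The functor sending a scheme over `ℂ` to its complex points with the classical topology. -/
def pointsFunctor : Over SpecC ⥤ TopCat.{0} where
  obj X := TopCat.of (Points X)
  map g := TopCat.ofHom ⟨Points.map g, Points.continuous_map g⟩
  map_id X := by
    ext x
    exact Category.comp_id (obj := Over SpecC) (X := Over.mk (𝟙 SpecC)) x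
  map_comp f g := by
    ext x
    exact (Category.assoc (obj := Over SpecC) (W := Over.mk (𝟙 SpecC)) x f g).symm

/-- The functor `X ↦ H^i(X(ℂ), ℚ)` on schemes over `ℂ`. -/
def cohomology (i : ℤ) : (Over SpecC)ᵒᵖ ⥤ ModuleCat.{0} ℚ :=
  pointsFunctor.op ⋙ singularCohomologyFunctor i

/-! ### Projective varieties, hypersurfaces, linear equivalence -/

attribute [local instance] MvPolynomial.gradedAlgebra

/-- Projective `n`-space over `ℂ`. -/
abbrev ProjectiveSpace (n : ℕ) : Scheme.{0} :=
  Proj (MvPolynomial.homogeneousSubmodule (Fin (n + 1)) ℂ)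

/-- The structure morphism of projective space over `ℂ`. -/
def ProjectiveSpace.toSpecC (n : ℕ) : ProjectiveSpace n ⟶ SpecC :=
  Proj.toSpecZero (MvPolynomial.homogeneousSubmodule (Fin (n + 1)) ℂ) ≫
    Spec.map (CommRingCat.ofHom
      (algebraMap ℂ (MvPolynomial.homogeneousSubmodule (Fin (n + 1)) ℂ 0)))

/-- A scheme over `ℂ` is projective if it is isomorphic over `ℂ` to a closed subscheme of some
projective space. -/
def IsProjective {X : Scheme.{0}} (p : X ⟶ SpecC) : Prop :=
  ∃ (n : ℕ) (j : X ⟶ ProjectiveSpace n),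
    IsClosedImmersion j ∧ j ≫ ProjectiveSpace.toSpecC n = p

/-- A closed subscheme `D` (given by its ideal sheaf) of an integral scheme `X` is a hypersurface
(an effective Cartier divisor) if it is locally cut out by one nonzero equation. -/
def IsHypersurface {X : Scheme.{0}} (D : X.IdealSheafData) : Prop :=
  ∀ x : X, ∃ U : X.affineOpens, x ∈ U.1 ∧
    ∃ g : Γ(X, U.1), g ≠ 0 ∧ D.ideal U = Ideal.span {g}

/-- Two hypersurfaces are linearly equivalent if `D₀ - D₁ = div f` for a nonzero rational function
`f`: near every point, `f = g₀ / g₁` for local equations `g₀` of `D₀` and `g₁` of `D₁`. -/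
def LinearlyEquivalent {X : Scheme.{0}} [IsIntegral X] (D₀ D₁ : X.IdealSheafData) : Prop :=
  ∃ f : X.functionField, f ≠ 0 ∧
    ∀ x : X, ∃ (U : X.affineOpens) (hx : x ∈ U.1) (g₀ g₁ : Γ(X, U.1)),
      D₀.ideal U = Ideal.span {g₀} ∧ D₁.ideal U = Ideal.span {g₁} ∧
      haveI : Nonempty U.1 := ⟨⟨x, hx⟩⟩
      X.germToFunctionField U.1 g₀ = f * X.germToFunctionField U.1 g₁

/-- The closed subscheme given by an ideal sheaf, as a scheme over `ℂ`. -/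
def subschemeOver {X : Scheme.{0}} (p : X ⟶ SpecC) (D : X.IdealSheafData) : Over SpecC :=
  Over.mk (D.subschemeι ≫ p)

/-- The inclusion `Z ⟶ D` over `ℂ` of closed subschemes of `X` with `Z ⊆ D`
(that is, the ideal sheaf of `D` is contained in that of `Z`). -/
def inclusionOver {X : Scheme.{0}} (p : X ⟶ SpecC) {D Z : X.IdealSheafData} (h : D ≤ Z) :
    subschemeOver p Z ⟶ subschemeOver p D :=
  Over.homMk (Scheme.IdealSheafData.inclusion h) (by simp [subschemeOver])

/-- The restriction map `H^i(D, ℚ) → H^i(Z, ℚ)` for closed subschemes `Z ⊆ D` of `X`. -/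
def restriction {X : Scheme.{0}} (p : X ⟶ SpecC) {D Z : X.IdealSheafData} (h : D ≤ Z) (i : ℤ) :
    (cohomology i).obj (op (subschemeOver p D)) →ₗ[ℚ]
      (cohomology i).obj (op (subschemeOver p Z)) :=
  ((cohomology i).map (inclusionOver p h).op).hom

end ComplexVariety

end

/-! Choose local equations `g₀`, `g₁` of the two hypersurfaces with `g₀ = f * g₁`. The local
functions `(1 - t) g₀ + t g₁` define a pencil `D_t` parametrized by `t ∈ ℂ`, joining `D₀` to `D₁`.
Changing the chart multiplies `g₀` and `g₁` by the same unit, because their quotient is the global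
function `f`, so the members and their singular points are well defined. Every `D_t` contains `Z`.

It suffices to have, in each direction, a continuous map between `D₀(ℂ)` and `D₁(ℂ)` that fixes
`Z(ℂ)` pointwise. If `Z → D'` factors through such a map as `Z → D → D'`, then every class
restricted from `D'` to `Z` is also restricted from `D` (`range_restriction_le`). No homeomorphism
and no Ehresmann-type trivialization is needed.

Such maps come from local retractions. At a point where `D_t` is nonsingular, the implicit function
theorem retracts a neighbourhood in `X(ℂ)` onto the nearby members, continuously in the parameter,
and every retraction is the identity on its target (`exists_pencil_retraction`). To go from `D_s` to
a nearby `D_t`, a partition of unity divides the way from `s` to `t` into steps, and each step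
applies one local retraction (`exists_partial_transport`, `eventually_hasTransport`). A base point
lies in all members, so no step moves it. Compactness of `X(ℂ)` makes finitely many steps suffice,
uniformly for `s`, `t` near a given parameter.

It remains to join `0` to `1` through parameters of nonsingular members. The singular parameters
form a closed set because `X(ℂ)` is compact. In each chart they are finite or cofinite by
Chevalley's theorem (`finite_or_finite_compl_singularValues`). Smoothness of `D₀` keeps a
neighbourhood of `0` free of them, so they are finite in number (`finite_singularValues`), and the
complement of a finite set in `ℂ` is connected. -/

noncomputable section

namespace ComplexVariety

/-! ### Families of subsets with local retractions -/

section Retractions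

open Topology Set

variable {P : Type*} [TopologicalSpace P]

/-- Near `(x₀, t₀)`, the members `S t` of the family are retracts of an open set of `P`,
continuously in `t`. -/
def HasLocalRetraction (S : ℂ → Set P) (x₀ : P) (t₀ : ℂ) : Prop :=
  ∃ Ω : Set (P × ℂ), IsOpen Ω ∧ (x₀, t₀) ∈ Ω ∧ ∃ r : P × ℂ → P, ContinuousOn r Ω ∧
    ∀ q ∈ Ω, r q ∈ S q.2 ∧ (q.1 ∈ S q.2 → r q = q.1)

/-- There is a continuous map from `S s` to `S t` which fixes all points of `Z`. -/
def HasTransport (S : ℂ → Set P) (Z : Set P) (s t : ℂ) : Prop :=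
  ∃ φ : S s → S t, Continuous φ ∧ ∀ x : S s, (x : P) ∈ Z → (φ x : P) = x

lemma HasTransport.trans {S : ℂ → Set P} {Z : Set P} {s t u : ℂ}
    (h₁ : HasTransport S Z s t) (h₂ : HasTransport S Z t u) : HasTransport S Z s u := by
  obtain ⟨φ, hφ, hφZ⟩ := h₁
  obtain ⟨ψ, hψ, hψZ⟩ := h₂
  refine ⟨ψ ∘ φ, hψ.comp hφ, fun x hx => ?_⟩
  have h := hφZ x hx
  rw [Function.comp_apply, hψZ _ (by rwa [h]), h]

/-- The total space of pairs of a point `x ∈ S s` and a target parameter `t`. -/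
abbrev TransportSpace (S : ℂ → Set P) : Type _ := {q : P × ℂ × ℂ // q.1 ∈ S q.2.1}

/-- Part of the way from the first to the second parameter. -/
def partialTime (S : ℂ → Set P) (σ : P → ℝ) (q : TransportSpace S) : ℂ :=
  q.1.2.1 + (σ q.1.1 : ℂ) * (q.1.2.2 - q.1.2.1)

lemma continuous_partialTime (S : ℂ → Set P) {σ : P → ℝ} (hσ : Continuous σ) :
    Continuous (partialTime S σ) := by
  unfold partialTime
  fun_prop

/-- Induction on the finite set of retractions: adding the index `a` advances the parameter by `l a
x` times the full difference, and `r a` carries the point already reached into the new member. The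
value for `(t₀, t₀)` is recorded because it keeps the next retraction defined near the diagonal
point. -/
lemma exists_partial_transport {S : ℂ → Set P} {t₀ : ℂ} {ι : Type*} (s : Finset ι)
    (l : ι → P → ℝ) (hl : ∀ i, Continuous (l i))
    (Ω : ι → Set (P × ℂ)) (hΩ : ∀ i, IsOpen (Ω i))
    (r : ι → P × ℂ → P) (hr : ∀ i, ContinuousOn (r i) (Ω i))
    (hrS : ∀ i, ∀ q ∈ Ω i, r i q ∈ S q.2 ∧ (q.1 ∈ S q.2 → r i q = q.1))
    (hsupp : ∀ i, ∀ x ∈ tsupport (l i), x ∈ S t₀ → (x, t₀) ∈ Ω i) :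
    ∃ (O : Set (TransportSpace S)) (Φ : TransportSpace S → P), IsOpen O ∧ ContinuousOn Φ O ∧
      (∀ q : TransportSpace S, q.1.2 = (t₀, t₀) → q ∈ O ∧ Φ q = q.1.1) ∧
      (∀ q ∈ O, Φ q ∈ S (partialTime S (fun x => ∑ i ∈ s, l i x) q)) ∧
      ∀ q ∈ O, (∀ t, q.1.1 ∈ S t) → Φ q = q.1.1 := by
  classical
  induction s using Finset.induction_on with
  | empty =>
    refine ⟨univ, fun q => q.1.1, isOpen_univ, by fun_prop, fun q _ => ⟨trivial, rfl⟩, ?_, ?_⟩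
    · intro q _
      simpa [partialTime] using q.2
    · intro q _ _
      rfl
  | insert a s ha ih =>
    obtain ⟨O, Φ, hO, hΦ, hbase, hS, hfix⟩ := ih
    set τ := partialTime S (fun x => ∑ i ∈ insert a s, l i x) with hτ
    have hτc : Continuous τ := continuous_partialTime S (by fun_prop)
    -- On `O₁` the next retraction can be applied; on `O₂` the weight `l a` vanishes and nothing has
    -- to move. On the overlap the parameter has not changed, so the point is already in the target
    -- member and `r a` fixes it: the two formulas glue.
    let O₁ : Set (TransportSpace S) := O ∩ (fun q => (Φ q, τ q)) ⁻¹' Ω a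
    let O₂ : Set (TransportSpace S) := O ∩ (fun q => q.1.1) ⁻¹' (tsupport (l a))ᶜ
    have hpair : ContinuousOn (fun q => (Φ q, τ q)) O := hΦ.prodMk hτc.continuousOn
    have hO₁ : IsOpen O₁ := hpair.isOpen_inter_preimage hO (hΩ a)
    have hO₂ : IsOpen O₂ :=
      hO.inter ((isClosed_tsupport _).isOpen_compl.preimage (by fun_prop))
    have hτ₂ : ∀ q : TransportSpace S, q.1.1 ∉ tsupport (l a) →
        τ q = partialTime S (fun x => ∑ i ∈ s, l i x) q := by
      intro q hq
      simp [hτ, partialTime, Finset.sum_insert ha, image_eq_zero_of_notMem_tsupport hq]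
    let Ψ : TransportSpace S → P := fun q =>
      if q.1.1 ∈ tsupport (l a) then r a (Φ q, τ q) else Φ q
    have hΨ₁ : ∀ q ∈ O₁, Ψ q = r a (Φ q, τ q) := by
      intro q hq
      by_cases h : q.1.1 ∈ tsupport (l a)
      · simp [Ψ, h]
      · simp only [Ψ, h, if_false]
        refine ((hrS a _ hq.2).2 ?_).symm
        simpa [hτ₂ q h] using hS q hq.1
    have hΨ₂ : ∀ q ∈ O₂, Ψ q = Φ q := by
      intro q hq
      have h : q.1.1 ∉ tsupport (l a) := hq.2
      simp [Ψ, h]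
    refine ⟨O₁ ∪ O₂, Ψ, hO₁.union hO₂, ?_, ?_, ?_, ?_⟩
    · refine ContinuousOn.union_of_isOpen ?_ ?_ hO₁ hO₂
      · refine ContinuousOn.congr ?_ hΨ₁
        exact (hr a).comp (hpair.mono inter_subset_left) fun q hq => hq.2
      · exact (hΦ.mono inter_subset_left).congr hΨ₂
    · intro q hq
      have hb := hbase q hq
      have hτq : τ q = t₀ := by simp [hτ, partialTime, hq]
      have hqS : q.1.1 ∈ S t₀ := by simpa [hq] using q.2
      by_cases h : q.1.1 ∈ tsupport (l a)
      · have hmem : q ∈ O₁ := ⟨hb.1, by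
          simpa [hb.2, hτq] using hsupp a _ h hqS⟩
        refine ⟨Or.inl hmem, ?_⟩
        rw [hΨ₁ q hmem, (hrS a _ hmem.2).2 (by simpa [hb.2, hτq] using hqS)]
        exact hb.2
      · have hmem : q ∈ O₂ := ⟨hb.1, h⟩
        exact ⟨Or.inr hmem, by rw [hΨ₂ q hmem, hb.2]⟩
    · rintro q (hq | hq)
      · rw [hΨ₁ q hq]
        exact (hrS a _ hq.2).1
      · rw [hΨ₂ q hq, hτ₂ q hq.2]
        exact hS q hq.1
    · rintro q (hq | hq) hall
      · rw [hΨ₁ q hq, (hrS a _ hq.2).2 (by simpa [hfix q hq.1 hall] using hall _)]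
        exact hfix q hq.1 hall
      · rw [hΨ₂ q hq]
        exact hfix q hq.1 hall

variable [CompactSpace P] [T2Space P]

/-- A family of closed subsets of a compact space with local retractions near `S t₀` has
transport maps in both directions between any two members close to `S t₀`. -/
theorem eventually_hasTransport {S : ℂ → Set P} (hW : IsClosed {q : P × ℂ | q.1 ∈ S q.2})
    {t₀ : ℂ} (hret : ∀ x ∈ S t₀, HasLocalRetraction S x t₀) :
    ∃ V ∈ 𝓝 t₀, ∀ s ∈ V, ∀ t ∈ V, HasTransport S (⋂ t, S t) s t := by
  classical
  have hclosed : IsClosed (S t₀) := hW.preimage (f := fun x : P => (x, t₀)) (by fun_prop)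
  choose! Ω hΩ hxΩ r hr hrS using hret
  let N : P → Set P := fun x => (fun y => (y, t₀)) ⁻¹' (Ω x)
  have hNx : ∀ x : S t₀, (x : P) ∈ N x := fun x => hxΩ x x.2
  have hNo : ∀ x : S t₀, IsOpen (N x) := fun x => (hΩ x x.2).preimage (by fun_prop)
  obtain ⟨F, hF⟩ := hclosed.isCompact.elim_finite_subcover (fun x : S t₀ => N x) hNo
    (fun x hx => mem_iUnion.2 ⟨⟨x, hx⟩, hNx ⟨x, hx⟩⟩)
  have hUo : IsOpen (⋃ x ∈ F, N (x : P)) := isOpen_biUnion fun x _ => hNo x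
  -- The weights must sum to `1` on a whole neighbourhood `O'` of `S t₀`, since nearby members are
  -- not contained in `S t₀`.
  obtain ⟨O', hO', hSO', hO'U⟩ := normal_exists_closure_subset hclosed hUo hF
  obtain ⟨f, hf⟩ := PartitionOfUnity.exists_isSubordinate (isClosed_closure (s := O'))
    (fun x : F => N (x : S t₀)) (fun x => hNo x) (by
      intro y hy
      have := hO'U hy
      simp only [mem_iUnion] at this ⊢
      obtain ⟨x, hx, h⟩ := this
      exact ⟨⟨x, hx⟩, h⟩)
  obtain ⟨O, Φ, hO, hΦ, hbase, hS, hfix⟩ := exists_partial_transport (S := S) (t₀ := t₀)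
    (Finset.univ : Finset F) (fun i => f i) (fun i => (f i).continuous)
    (fun i => Ω (i : S t₀)) (fun i => hΩ _ i.1.2) (fun i => r (i : S t₀))
    (fun i => hr _ i.1.2) (fun i => hrS _ i.1.2) (fun i x hx _ => hf i hx)
  obtain ⟨O₀, hO₀, rfl⟩ := isOpen_induced_iff.1 hO
  -- Adjoining the triples with `x ∉ S s` gives an open set containing all of `P × {(t₀, t₀)}`, so
  -- the tube lemma applies; a point of `S s` in the tube then lies in the first part.
  let U : Set (P × ℂ × ℂ) := (O₀ ∩ Prod.fst ⁻¹' O') ∪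
    (fun q => (q.1, q.2.1)) ⁻¹' {q : P × ℂ | q.1 ∈ S q.2}ᶜ
  have hU : IsOpen U :=
    (hO₀.inter (hO'.preimage continuous_fst)).union (hW.isOpen_compl.preimage (by fun_prop))
  obtain ⟨A, B, -, hB, hA, htB, hAB⟩ := generalized_tube_lemma (s := univ) (t := {(t₀, t₀)})
    isCompact_univ isCompact_singleton hU (by
      rintro ⟨x, q⟩ ⟨-, rfl : q = _⟩
      by_cases hx : x ∈ S t₀
      · exact Or.inl ⟨(hbase ⟨(x, t₀, t₀), hx⟩ rfl).1, hSO' hx⟩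
      · exact Or.inr hx)
  obtain ⟨V₁, hV₁, V₂, hV₂, hV⟩ := mem_nhds_prod_iff.1 (hB.mem_nhds (htB rfl))
  refine ⟨V₁ ∩ V₂, Filter.inter_mem hV₁ hV₂, fun s hs t ht => ?_⟩
  have hmem : ∀ x : S s, ((x : P), s, t) ∈ O₀ ∩ Prod.fst ⁻¹' O' := by
    intro x
    rcases hAB (show ((x : P), s, t) ∈ A ×ˢ B from ⟨hA trivial, hV ⟨hs.1, ht.2⟩⟩) with h | h
    · exact h
    · exact absurd x.2 h
  let e : S s → TransportSpace S := fun x => ⟨(x, s, t), x.2⟩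
  have he : Continuous e := by fun_prop
  have hsum : ∀ x : S s, ∑ i : F, f i (x : P) = 1 := by
    intro x
    have := f.sum_eq_one (subset_closure (hmem x).2)
    rwa [finsum_eq_sum_of_fintype] at this
  have htime : ∀ x : S s, partialTime S (fun x => ∑ i : F, f i x) (e x) = t := by
    intro x
    simp only [partialTime, e, hsum x]
    push_cast
    ring
  refine ⟨fun x => ⟨Φ (e x), ?_⟩, ?_, ?_⟩
  · have := hS (e x) (hmem x).1
    rwa [htime x] at this
  · refine Continuous.subtype_mk ?_ _
    exact hΦ.comp_continuous he fun x => (hmem x).1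
  · intro x hx
    exact hfix (e x) (hmem x).1 (mem_iInter.1 hx)

/-- Transport is transitive and, near each parameter of `G`, available in both directions; on a
preconnected set such a relation holds between any two points. -/
theorem hasTransport_of_isPreconnected {S : ℂ → Set P}
    (hW : IsClosed {q : P × ℂ | q.1 ∈ S q.2}) {G : Set ℂ} (hG : IsPreconnected G)
    (hret : ∀ t ∈ G, ∀ x ∈ S t, HasLocalRetraction S x t) {s t : ℂ} (hs : s ∈ G) (ht : t ∈ G) :
    HasTransport S (⋂ t, S t) s t := by
  refine hG.induction₂' (HasTransport S (⋂ t, S t)) (fun t ht => ?_)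
    (fun _ _ _ _ _ _ h₁ h₂ => h₁.trans h₂) hs ht
  obtain ⟨V, hV, h⟩ := eventually_hasTransport hW (hret t ht)
  filter_upwards [mem_nhdsWithin_of_mem_nhds hV] with u hu
  exact ⟨h _ (mem_of_mem_nhds hV) _ hu, h _ hu _ (mem_of_mem_nhds hV)⟩

end Retractions

/-! ### Local retractions onto the zero sets of a submersive family -/

section Submersion

open Topology Set

/-- Let `R` be a linear right inverse of the differential along `E`. The equation `F (y + R τ, t) =
0` has derivative the identity in `τ`, so it has a local solution `τ = ψ (y, t)`, and `y + R (ψ (y,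
t))` is the retraction. -/
theorem exists_local_retraction_of_surjective {E G : Type*}
    [NormedAddCommGroup E] [NormedSpace ℂ E] [CompleteSpace E]
    [NormedAddCommGroup G] [NormedSpace ℂ G] [FiniteDimensional ℂ G]
    {F : E × ℂ → G} (hF : ContDiff ℂ 1 F) {y₀ : E} {t₀ : ℂ} (h₀ : F (y₀, t₀) = 0)
    (hsurj : Function.Surjective (fderiv ℂ F (y₀, t₀) ∘L .inl ℂ E ℂ)) :
    ∃ Ω : Set (E × ℂ), IsOpen Ω ∧ (y₀, t₀) ∈ Ω ∧ ∃ ρ : E × ℂ → E, ContinuousOn ρ Ω ∧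
      ∀ q ∈ Ω, F (ρ q, q.2) = 0 ∧ (F q = 0 → ρ q = q.1) := by
  have : CompleteSpace G := FiniteDimensional.complete ℂ G
  obtain ⟨R₀, hR₀⟩ := (fderiv ℂ F (y₀, t₀) ∘L .inl ℂ E ℂ).toLinearMap.exists_rightInverse_of_surjective
    (LinearMap.range_eq_top.2 hsurj)
  let R : G →L[ℂ] E := LinearMap.toContinuousLinearMap R₀
  let m : (E × ℂ) × G →L[ℂ] E × ℂ :=
    ((ContinuousLinearMap.fst ℂ E ℂ ∘L .fst ℂ (E × ℂ) G) + R ∘L .snd ℂ (E × ℂ) G).prod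
      (ContinuousLinearMap.snd ℂ E ℂ ∘L .fst ℂ (E × ℂ) G)
  have hm : ∀ q τ, m (q, τ) = (q.1 + R τ, q.2) := fun q τ => rfl
  let f : (E × ℂ) × G → G := fun w => F (m w)
  let u : (E × ℂ) × G := ((y₀, t₀), 0)
  have hmu : m u = (y₀, t₀) := by simp [u, hm]
  have cdf : ContDiffAt ℂ 1 f u := (hF.comp m.contDiff).contDiffAt
  have hfd : fderiv ℂ f u = fderiv ℂ F (y₀, t₀) ∘L m := by
    have h1 : HasFDerivAt F (fderiv ℂ F (y₀, t₀)) (m u) := by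
      rw [hmu]
      exact (hF.differentiable one_ne_zero _).hasFDerivAt
    exact (h1.comp u m.hasFDerivAt).fderiv
  have hid : fderiv ℂ f u ∘L .inr ℂ (E × ℂ) G = .id ℂ G := by
    ext τ
    have h2 := LinearMap.congr_fun hR₀ τ
    rw [hfd]
    simpa [hm, R] using h2
  have hinv : (fderiv ℂ f u ∘L .inr ℂ (E × ℂ) G).IsInvertible := by
    rw [hid]
    exact ⟨.refl ℂ G, rfl⟩
  let ψ := cdf.implicitFunction one_ne_zero hinv
  have hψu : ψ (y₀, t₀) = 0 := cdf.implicitFunction_apply_self one_ne_zero hinv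
  have hfu : f u = 0 := by simp only [f, hmu, h₀]
  have hψc : ∀ᶠ q in 𝓝 (y₀, t₀), ContinuousAt ψ q := by
    filter_upwards [(cdf.contDiffAt_implicitFunction one_ne_zero hinv).eventually (by simp)]
      with q hq using hq.continuousAt
  have hzero : ∀ᶠ q in 𝓝 (y₀, t₀), f (q, ψ q) = 0 := by
    filter_upwards [cdf.eventually_apply_implicitFunction one_ne_zero hinv] with q hq
    rw [← hfu]
    exact hq
  -- If `y` already solves the equation, then `τ = 0` is a solution; local uniqueness makes it the
  -- chosen one.
  have huniq : ∀ᶠ q in 𝓝 (y₀, t₀), f (q, 0) = 0 → ψ q = 0 := by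
    have hc : Filter.Tendsto (fun q : E × ℂ => (q, (0 : G))) (𝓝 (y₀, t₀)) (𝓝 u) :=
      (Continuous.prodMk_left (0 : G)).tendsto _
    filter_upwards [hc.eventually (cdf.eventually_apply_eq_iff_implicitFunction one_ne_zero hinv)]
      with q hq h
    exact hq.1 (by rw [h, hfu])
  obtain ⟨Ω, hΩ, hΩo, hmem⟩ := eventually_nhds_iff.1 (hψc.and (hzero.and huniq))
  refine ⟨Ω, hΩo, hmem, fun q => q.1 + R (ψ q), ?_, fun q hq => ⟨?_, fun h => ?_⟩⟩
  · intro q hq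
    refine ContinuousAt.continuousWithinAt ?_
    exact continuousAt_fst.add (R.continuous.continuousAt.comp (hΩ q hq).1)
  · exact (hΩ q hq).2.1
  · have : ψ q = 0 := (hΩ q hq).2.2 (by simpa [f, hm] using h)
    simp [this]

variable {ι : Type*} [Fintype ι]

lemma contDiff_mvPolynomial_eval (p : MvPolynomial ι ℂ) :
    ContDiff ℂ 1 (fun y : ι → ℂ => MvPolynomial.eval y p) := by
  induction p using MvPolynomial.induction_on with
  | C a => simpa using contDiff_const
  | add p q hp hq => simpa using hp.add hq
  | mul_X p i hp => simpa using hp.mul (contDiff_apply ℂ ℂ i)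

/-- The differential of a polynomial at a point. -/
def mvPolynomialDifferential (p : MvPolynomial ι ℂ) (y : ι → ℂ) : (ι → ℂ) →L[ℂ] ℂ :=
  ∑ i, MvPolynomial.eval y (MvPolynomial.pderiv i p) • ContinuousLinearMap.proj i

lemma mvPolynomialDifferential_apply (p : MvPolynomial ι ℂ) (y v : ι → ℂ) :
    mvPolynomialDifferential p y v = ∑ i, MvPolynomial.eval y (MvPolynomial.pderiv i p) * v i := by
  simp [mvPolynomialDifferential]

lemma hasFDerivAt_mvPolynomial_eval (p : MvPolynomial ι ℂ) (y : ι → ℂ) :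
    HasFDerivAt (fun y : ι → ℂ => MvPolynomial.eval y p) (mvPolynomialDifferential p y) y := by
  classical
  induction p using MvPolynomial.induction_on with
  | C a =>
    have : mvPolynomialDifferential (MvPolynomial.C a) y = 0 := by
      ext
      simp [mvPolynomialDifferential_apply]
    rw [this]
    simpa using hasFDerivAt_const (𝕜 := ℂ) a y
  | add p q hp hq =>
    have : mvPolynomialDifferential (p + q) y =
        mvPolynomialDifferential p y + mvPolynomialDifferential q y := by
      ext
      simp [mvPolynomialDifferential_apply, add_mul, Finset.sum_add_distrib]
    rw [this]
    simp only [map_add]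
    exact hp.add hq
  | mul_X p i hp =>
    have h := hp.mul (hasFDerivAt_apply (𝕜 := ℂ) i y)
    simp only [map_mul, MvPolynomial.eval_X]
    refine h.congr_fderiv ?_
    ext v
    simp only [mvPolynomialDifferential_apply, add_apply,
      smul_apply, ContinuousLinearMap.proj_apply, smul_eq_mul,
      Derivation.leibniz, MvPolynomial.pderiv_X, map_add, map_mul, MvPolynomial.eval_X, add_mul,
      Finset.sum_add_distrib, Finset.mul_sum]
    congr 1
    · simp [Pi.single_apply, ite_mul, apply_ite]
    · exact Finset.sum_congr rfl fun _ _ => by ring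

/-- The first-order Taylor formula `p (y + ε v) = p y + ε dp_y(v)`. It translates homomorphisms to
the dual numbers into vectors killed by the differentials of the relations. -/
lemma dualNumber_aeval (p : MvPolynomial ι ℂ) (w : ι → DualNumber ℂ) :
    (MvPolynomial.aeval w p).fst = MvPolynomial.eval (fun i => (w i).fst) p ∧
    (MvPolynomial.aeval w p).snd =
      mvPolynomialDifferential p (fun i => (w i).fst) (fun i => (w i).snd) := by
  classical
  induction p using MvPolynomial.induction_on with
  | C a => simp [mvPolynomialDifferential, TrivSqZeroExt.algebraMap_eq_inl']
  | add p q hp hq =>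
    simp [mvPolynomialDifferential_apply] at hp hq ⊢
    simp [hp, hq, add_mul, Finset.sum_add_distrib]
  | mul_X p i hp =>
    rw [map_mul, MvPolynomial.aeval_X, TrivSqZeroExt.fst_mul, TrivSqZeroExt.snd_mul, hp.1, hp.2]
    refine ⟨by simp, ?_⟩
    simp only [mvPolynomialDifferential_apply, smul_eq_mul, MulOpposite.smul_eq_mul_unop,
      MulOpposite.unop_op,
      Derivation.leibniz, MvPolynomial.pderiv_X, map_add, map_mul, MvPolynomial.eval_X, add_mul,
      Finset.sum_add_distrib, Finset.sum_mul]
    congr 1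
    · simp [Pi.single_apply, ite_mul, apply_ite]
    · exact Finset.sum_congr rfl fun _ _ => by ring

end Submersion

/-! ### Complex points of affine algebras -/

section AffinePoints

open Topology Set

variable {A : Type*} [CommRing A] [Algebra ℂ A]

/-- The topology of pointwise convergence on the complex points of an algebra. -/
instance affinePointsTopology : TopologicalSpace (A →ₐ[ℂ] ℂ) :=
  TopologicalSpace.induced (fun φ (a : A) => φ a) inferInstance

lemma continuous_affinePoints_apply (a : A) : Continuous fun φ : A →ₐ[ℂ] ℂ => φ a :=
  (continuous_apply a).comp continuous_induced_dom

lemma apply_aeval_eq_eval {ι : Type*} (s : ι → A) (φ : A →ₐ[ℂ] ℂ) (p : MvPolynomial ι ℂ) :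
    φ (MvPolynomial.aeval s p) = MvPolynomial.eval (fun i => φ (s i)) p := by
  rw [← AlgHom.comp_apply, MvPolynomial.comp_aeval, MvPolynomial.aeval_eq_eval]

/-- A point of affine space comes from a complex point of the algebra if and only if it satisfies
all relations between the generators. -/
lemma range_coordinates {ι : Type*} (s : ι → A)
    (hs : Function.Surjective (MvPolynomial.aeval (R := ℂ) s)) :
    range (fun (φ : A →ₐ[ℂ] ℂ) (i : ι) => φ (s i)) =
      {y | ∀ p : MvPolynomial ι ℂ, MvPolynomial.aeval s p = 0 → MvPolynomial.eval y p = 0} := by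
  ext y
  simp only [mem_range, mem_ofPred_eq]
  constructor
  · rintro ⟨φ, rfl⟩ p hp
    rw [← apply_aeval_eq_eval, hp, map_zero]
  · intro h
    refine ⟨(Ideal.Quotient.liftₐ (RingHom.ker (MvPolynomial.aeval (R := ℂ) s))
      (MvPolynomial.aeval y) ?_).comp
        (Ideal.quotientKerAlgEquivOfSurjective hs).symm.toAlgHom, ?_⟩
    · intro p hp
      rw [MvPolynomial.aeval_eq_eval]
      exact h p hp
    · ext i
      have : (Ideal.quotientKerAlgEquivOfSurjective hs).symm (s i) =
          Ideal.Quotient.mk _ (MvPolynomial.X i) := by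
        rw [AlgEquiv.symm_apply_eq]
        exact (MvPolynomial.aeval_X s i).symm
      simp [this]

/-- Finitely many generators of an algebra embed its complex points as a closed subset of affine
space. -/
lemma isClosedEmbedding_coordinates {ι : Type*} [Finite ι] (s : ι → A)
    (hs : Function.Surjective (MvPolynomial.aeval (R := ℂ) s)) :
    IsClosedEmbedding fun (φ : A →ₐ[ℂ] ℂ) (i : ι) => φ (s i) := by
  cases nonempty_fintype ι
  have hcont : Continuous fun (φ : A →ₐ[ℂ] ℂ) (i : ι) => φ (s i) :=
    continuous_pi fun i => continuous_affinePoints_apply _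
  have heval := fun (φ : A →ₐ[ℂ] ℂ) p => apply_aeval_eq_eval s φ p
  refine ⟨⟨⟨le_antisymm hcont.le_induced ?_⟩, ?_⟩, ?_⟩
  -- Writing each `a` as a polynomial in the generators makes its value continuous in the
  -- coordinates.
  · choose p hp using hs
    have hH : Continuous fun (y : ι → ℂ) (a : A) => MvPolynomial.eval y (p a) :=
      continuous_pi fun a => (contDiff_mvPolynomial_eval (p a)).continuous
    have hcomp : (fun (φ : A →ₐ[ℂ] ℂ) (a : A) => φ a) =
        (fun (y : ι → ℂ) (a : A) => MvPolynomial.eval y (p a)) ∘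
          fun (φ : A →ₐ[ℂ] ℂ) (i : ι) => φ (s i) := by
      ext φ a
      rw [Function.comp_apply, ← heval, hp]
    rw [affinePointsTopology, hcomp, ← induced_compose]
    exact induced_mono hH.le_induced
  · intro φ ψ h
    ext a
    obtain ⟨p, rfl⟩ := hs a
    rw [heval, heval]
    exact congrArg (fun y => MvPolynomial.eval y p) h
  · rw [range_coordinates s hs]
    simp only [ofPred_forall]
    exact isClosed_iInter fun p => isClosed_iInter fun _ =>
      isClosed_singleton.preimage (contDiff_mvPolynomial_eval p).continuous

instance : T2Space (A →ₐ[ℂ] ℂ) :=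
  T2Space.of_injective_continuous (f := fun (φ : A →ₐ[ℂ] ℂ) (a : A) => φ a)
    DFunLike.coe_injective continuous_induced_dom

/-- The member of the pencil spanned by two functions. -/
def pencil (g₀ g₁ : A) (t : ℂ) : A := (1 - t) • g₀ + t • g₁

lemma apply_pencil {B : Type*} [CommRing B] [Algebra ℂ B] (φ : A →ₐ[ℂ] B) (g₀ g₁ : A) (t : ℂ) :
    φ (pencil g₀ g₁ t) = pencil (φ g₀) (φ g₁) t := by
  simp [pencil]

lemma continuous_pencil_apply (g₀ g₁ : A) :
    Continuous fun q : (A →ₐ[ℂ] ℂ) × ℂ => q.1 (pencil g₀ g₁ q.2) := by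
  have h₀ := (continuous_affinePoints_apply g₀).comp
    (continuous_fst (X := A →ₐ[ℂ] ℂ) (Y := ℂ))
  have h₁ := (continuous_affinePoints_apply g₁).comp
    (continuous_fst (X := A →ₐ[ℂ] ℂ) (Y := ℂ))
  simp only [pencil, map_add, map_smul, smul_eq_mul]
  exact ((continuous_const.sub continuous_snd).mul h₀).add (continuous_snd.mul h₁)

/-- The tangent vectors at the complex point `φ`. -/
def IsTangentAt (φ : A →ₐ[ℂ] ℂ) (ψ : A →ₐ[ℂ] DualNumber ℂ) : Prop :=
  ∀ a, (ψ a).fst = φ a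

/-- `g` vanishes to second order at the complex point `φ`, as tested by tangent vectors. -/
def IsSingularAt (g : A) (φ : A →ₐ[ℂ] ℂ) : Prop :=
  ∀ ψ : A →ₐ[ℂ] DualNumber ℂ, IsTangentAt φ ψ → ψ g = 0

/-- The Jacobian minor on the variables `P.map k` is a unit of `A`, hence invertible at `φ`; the
system is solved in these variables alone. -/
lemma surjective_differential {ι σ : Type*} [Fintype ι] [Finite σ]
    (P : Algebra.SubmersivePresentation ℂ A ι σ) (φ : A →ₐ[ℂ] ℂ) (w : σ → ℂ) :
    ∃ v : ι → ℂ, ∀ k, mvPolynomialDifferential (P.relation k) (fun i => φ (P.val i)) v = w k := by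
  classical
  cases nonempty_fintype σ
  have hunit := P.jacobian_isUnit.map φ
  rw [P.jacobian_eq_jacobiMatrix_det, ← AlgHom.coe_toRingHom, ← RingHom.comp_apply,
    RingHom.map_det] at hunit
  set M := ((φ : A →+* ℂ).comp (algebraMap P.Ring A)).mapMatrix P.jacobiMatrix with hM
  have hMij : ∀ i j, M i j = MvPolynomial.eval (fun i => φ (P.val i))
      (MvPolynomial.pderiv (P.map i) (P.relation j)) := by
    intro i j
    rw [← apply_aeval_eq_eval, hM]
    simp [P.jacobiMatrix_apply, P.algebraMap_apply]
  -- Rows of `M` are variables and columns are relations, so the coefficient vector multiplies from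
  -- the left.
  let c := Matrix.vecMul w M⁻¹
  have hc : Matrix.vecMul c M = w := by
    simp [c, Matrix.vecMul_vecMul, Matrix.nonsing_inv_mul M hunit]
  refine ⟨∑ k, c k • Pi.single (P.map k) 1, fun j => ?_⟩
  rw [← hc, map_sum]
  simp only [Matrix.vecMul, dotProduct, hMij, map_smul, smul_eq_mul,
    mvPolynomialDifferential_apply]
  refine Finset.sum_congr rfl fun k _ => ?_
  simp [Pi.single_apply]

/-- Near a point where `g_t` is nonsingular, the zero sets of the pencil `g_t` are local retracts
of the complex points of a standard smooth algebra, continuously in `t`. -/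
theorem exists_pencil_retraction {ι σ : Type*} [Finite ι] [Finite σ]
    (P : Algebra.SubmersivePresentation ℂ A ι σ) (g₀ g₁ : A) {φ₀ : A →ₐ[ℂ] ℂ} {t₀ : ℂ}
    (h₀ : φ₀ (pencil g₀ g₁ t₀) = 0) (hns : ¬ IsSingularAt (pencil g₀ g₁ t₀) φ₀) :
    HasLocalRetraction (fun t => {φ : A →ₐ[ℂ] ℂ | φ (pencil g₀ g₁ t) = 0}) φ₀ t₀ := by
  classical
  cases nonempty_fintype ι
  cases nonempty_fintype σ
  simp only [IsSingularAt, not_forall] at hns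
  obtain ⟨ψ, hψ, hne⟩ := hns
  have hsurj := P.aeval_val_surjective
  have hemb := isClosedEmbedding_coordinates P.val hsurj
  set e := fun (φ : A →ₐ[ℂ] ℂ) (i : ι) => φ (P.val i) with he
  let G₀ : MvPolynomial ι ℂ := P.σ g₀
  let G₁ : MvPolynomial ι ℂ := P.σ g₁
  -- The relations of the presentation together with the equation of the pencil: the zeros of `F`
  -- are exactly the points of the members in coordinates.
  let F : (ι → ℂ) × ℂ → (σ → ℂ) × ℂ := fun q =>
    (fun k => MvPolynomial.eval q.1 (P.relation k),
      (1 - q.2) * MvPolynomial.eval q.1 G₀ + q.2 * MvPolynomial.eval q.1 G₁)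
  have hG : ∀ φ t, φ (pencil g₀ g₁ t) =
      (1 - t) * MvPolynomial.eval (e φ) G₀ + t * MvPolynomial.eval (e φ) G₁ := by
    intro φ t
    simp only [he, ← apply_aeval_eq_eval, G₀, G₁, P.aeval_val_σ, pencil, map_add, map_smul,
      smul_eq_mul]
  have hrel : ∀ φ k, MvPolynomial.eval (e φ) (P.relation k) = 0 := by
    intro φ k
    rw [← apply_aeval_eq_eval, P.aeval_val_relation, map_zero]
  have hFe : ∀ φ t, F (e φ, t) = 0 ↔ φ (pencil g₀ g₁ t) = 0 := by
    intro φ t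
    simp only [F, Prod.mk_eq_zero, hG]
    exact ⟨fun h => h.2, fun h => ⟨funext (hrel φ), h⟩⟩
  have hFrange : ∀ q : (ι → ℂ) × ℂ, F q = 0 → q.1 ∈ range e := by
    intro q hq
    rw [range_coordinates P.val hsurj]
    intro p hp
    have hle : P.ker ≤ RingHom.ker (MvPolynomial.eval q.1) := by
      rw [← P.span_range_relation_eq_ker, Ideal.span_le]
      rintro _ ⟨k, rfl⟩
      exact congrFun (congrArg Prod.fst hq) k
    exact hle (by rw [P.ker_eq_ker_aeval_val]; exact hp)
  have hFc : ContDiff ℂ 1 F := by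
    have h := fun p => (contDiff_mvPolynomial_eval (ι := ι) p).comp
      (contDiff_fst (𝕜 := ℂ) (E := ι → ℂ) (F := ℂ))
    refine ContDiff.prodMk (contDiff_pi.2 fun k => h _) ?_
    exact ((contDiff_const.sub contDiff_snd).mul (h G₀)).add (contDiff_snd.mul (h G₁))
  have hFd : HasFDerivAt (fun y => F (y, t₀))
      ((ContinuousLinearMap.pi fun k => mvPolynomialDifferential (P.relation k) (e φ₀)).prod
        ((1 - t₀) • mvPolynomialDifferential G₀ (e φ₀) +
          t₀ • mvPolynomialDifferential G₁ (e φ₀))) (e φ₀) := by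
    refine HasFDerivAt.prodMk (hasFDerivAt_pi.2 fun k => hasFDerivAt_mvPolynomial_eval _ _) ?_
    exact ((hasFDerivAt_mvPolynomial_eval G₀ (e φ₀)).const_mul (1 - t₀)).add
      ((hasFDerivAt_mvPolynomial_eval G₁ (e φ₀)).const_mul t₀)
  have hFd' : fderiv ℂ F (e φ₀, t₀) ∘L .inl ℂ (ι → ℂ) ℂ =
      ((ContinuousLinearMap.pi fun k => mvPolynomialDifferential (P.relation k) (e φ₀)).prod
        ((1 - t₀) • mvPolynomialDifferential G₀ (e φ₀) +
          t₀ • mvPolynomialDifferential G₁ (e φ₀))) := by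
    refine HasFDerivAt.unique ?_ hFd
    exact ((hFc.differentiable one_ne_zero _).hasFDerivAt).comp (e φ₀)
      (hasFDerivAt_prodMk_left (e φ₀) t₀)
  have hψe : ∀ p, (ψ (MvPolynomial.aeval P.val p)).snd =
      mvPolynomialDifferential p (e φ₀) fun i => (ψ (P.val i)).snd := by
    intro p
    rw [← AlgHom.comp_apply, MvPolynomial.comp_aeval, (dualNumber_aeval p _).2]
    simp only [hψ _, he]
  have hsurjF : Function.Surjective (fderiv ℂ F (e φ₀, t₀) ∘L .inl ℂ (ι → ℂ) ℂ) := by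
    rw [hFd']
    rintro ⟨w, c⟩
    obtain ⟨v, hv⟩ := surjective_differential P φ₀ w
    let v₀ : ι → ℂ := fun i => (ψ (P.val i)).snd
    let L : (ι → ℂ) →L[ℂ] ℂ := (1 - t₀) • mvPolynomialDifferential G₀ (e φ₀) +
          t₀ • mvPolynomialDifferential G₁ (e φ₀)
    have hv₀ : ∀ k, mvPolynomialDifferential (P.relation k) (e φ₀) v₀ = 0 := by
      intro k
      rw [← hψe, P.aeval_val_relation, map_zero]
      rfl
    have hL : L v₀ ≠ 0 := by
      intro hL
      refine hne (TrivSqZeroExt.ext ((hψ _).trans h₀) ?_)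
      rw [← P.aeval_val_σ g₀, ← P.aeval_val_σ g₁, apply_pencil]
      simp only [pencil, TrivSqZeroExt.snd_add, TrivSqZeroExt.snd_smul, hψe]
      exact hL
    -- The vector `v` takes care of the relations. Nonsingularity supplies `v₀`, tangent to them
    -- with `L v₀ ≠ 0`, and a multiple of it corrects the last component.
    refine ⟨v + ((c - L v) / L v₀) • v₀, Prod.ext (funext fun k => ?_) ?_⟩
    · change mvPolynomialDifferential (P.relation k) (e φ₀) _ = w k
      rw [map_add, map_smul, hv₀, smul_zero, add_zero]
      exact hv k
    · change L _ = c
      rw [map_add, map_smul, smul_eq_mul, div_mul_cancel₀ _ hL]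
      ring
  obtain ⟨Ω, hΩ, hmem, ρ, hρ, hρF⟩ := exists_local_retraction_of_surjective hFc
    ((hFe φ₀ t₀).2 h₀) hsurjF
  have hec : Continuous fun q : (A →ₐ[ℂ] ℂ) × ℂ => (e q.1, q.2) :=
    (hemb.continuous.comp continuous_fst).prodMk continuous_snd
  have hex : ∀ q : (A →ₐ[ℂ] ℂ) × ℂ, (e q.1, q.2) ∈ Ω → ∃ φ, e φ = ρ (e q.1, q.2) :=
    fun q hq => hFrange (ρ (e q.1, q.2), q.2) (hρF _ hq).1
  have : Nonempty (A →ₐ[ℂ] ℂ) := ⟨φ₀⟩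
  choose! r hr using hex
  refine ⟨(fun q => (e q.1, q.2)) ⁻¹' Ω, hΩ.preimage hec, hmem, r, ?_, fun q hq => ⟨?_, fun h => ?_⟩⟩
  · rw [hemb.isInducing.continuousOn_iff]
    refine ContinuousOn.congr (hρ.comp hec.continuousOn fun q hq => hq) fun q hq => hr q hq
  · change r q (pencil g₀ g₁ q.2) = 0
    rw [← hFe, hr q hq]
    exact (hρF _ hq).1
  · refine hemb.injective ?_
    rw [hr q hq]
    exact (hρF _ hq).2 ((hFe _ _).2 h)

end AffinePoints

/-! ### Tangent vectors and singular values of a pencil -/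

section Singular

open Topology Set

variable {A : Type*} [CommRing A] [Algebra ℂ A]

/-- The tangent vector at `φ` given by a derivation at `φ`. -/
def tangentOfDerivation (φ : A →ₐ[ℂ] ℂ) (δ : A → ℂ) (hadd : ∀ a b, δ (a + b) = δ a + δ b)
    (hmul : ∀ a b, δ (a * b) = φ a * δ b + φ b * δ a) (hconst : ∀ c, δ (algebraMap ℂ A c) = 0) :
    A →ₐ[ℂ] DualNumber ℂ where
  toFun a := TrivSqZeroExt.inl (φ a) + TrivSqZeroExt.inr (δ a)
  map_one' := by
    have := hconst 1
    rw [map_one] at this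
    simp [this]
  map_mul' a b := by
    ext
    · simp
    · simp [hmul, mul_comm]
  map_zero' := by
    have := hconst 0
    rw [map_zero] at this
    simp [this]
  map_add' a b := by
    ext <;> simp [hadd]
  commutes' c := by
    ext <;> simp [hconst, TrivSqZeroExt.algebraMap_eq_inl']

lemma isTangentAt_tangentOfDerivation (φ : A →ₐ[ℂ] ℂ) (δ : A → ℂ) (hadd hmul hconst) :
    IsTangentAt φ (tangentOfDerivation φ δ hadd hmul hconst) := by
  intro a
  simp [tangentOfDerivation]

lemma snd_tangentOfDerivation (φ : A →ₐ[ℂ] ℂ) (δ : A → ℂ) (hadd hmul hconst) (a : A) :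
    (tangentOfDerivation φ δ hadd hmul hconst a).snd = δ a := by
  simp [tangentOfDerivation]

/-- The zero tangent vector already tests the value of `g`. -/
lemma IsSingularAt.apply_eq_zero {g : A} {φ : A →ₐ[ℂ] ℂ} (h : IsSingularAt g φ) : φ g = 0 := by
  have := h (tangentOfDerivation φ (fun _ => 0) (by simp) (by simp) (by simp))
    (isTangentAt_tangentOfDerivation _ _ _ _ _)
  rw [← isTangentAt_tangentOfDerivation φ (fun _ => 0) (by simp) (by simp) (by simp), this]
  rfl

/-- A local equation of a smooth hypersurface is nowhere singular. -/
theorem not_isSingularAt_of_formallySmooth [IsDomain A] {g : A} (hg : g ≠ 0)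
    [Algebra.FormallySmooth ℂ (A ⧸ Ideal.span {g})] (φ : A →ₐ[ℂ] ℂ) : ¬ IsSingularAt g φ := by
  intro hsing
  have hφg := hsing.apply_eq_zero
  set I : Ideal A := Ideal.span {g} with hI
  let q : A ⧸ I ^ 2 →ₐ[ℂ] A ⧸ I := Ideal.Quotient.factorₐ ℂ (Ideal.pow_le_self two_ne_zero)
  have hq : ∀ a, q (Ideal.Quotient.mk _ a) = Ideal.Quotient.mk _ a := fun a => rfl
  have hqs : Function.Surjective q := Ideal.Quotient.factor_surjective (Ideal.pow_le_self two_ne_zero)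
  have hker : RingHom.ker (q : A ⧸ I ^ 2 →+* A ⧸ I) = I.map (Ideal.Quotient.mk (I ^ 2)) := by
    ext x
    obtain ⟨a, rfl⟩ := Ideal.Quotient.mk_surjective x
    rw [RingHom.mem_ker, RingHom.coe_coe, hq, Ideal.Quotient.eq_zero_iff_mem,
      Ideal.mem_quotient_iff_mem (Ideal.pow_le_self two_ne_zero)]
  have hnil : IsNilpotent (RingHom.ker (q : A ⧸ I ^ 2 →+* A ⧸ I)) := by
    refine ⟨2, ?_⟩
    rw [hker, ← Ideal.map_pow, Ideal.map_quotient_self, Ideal.zero_eq_bot]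
  -- Formal smoothness splits the square-zero extension `A / I² → A / I`. The difference of `a` and
  -- its split image lies in `I / I²`, so it equals `g b`; the map `a ↦ φ b` will be a tangent
  -- vector on which `g` has derivative `1`.
  let σ : A ⧸ I →ₐ[ℂ] A ⧸ I ^ 2 :=
    Algebra.FormallySmooth.liftOfSurjective (AlgHom.id ℂ _) q hqs hnil
  have hσ : ∀ x, q (σ x) = x := fun x =>
    Algebra.FormallySmooth.liftOfSurjective_apply (AlgHom.id ℂ _) q hqs hnil x
  have hex : ∀ a : A, ∃ b : A, Ideal.Quotient.mk (I ^ 2) (g * b) =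
      Ideal.Quotient.mk (I ^ 2) a - σ (Ideal.Quotient.mk I a) := by
    intro a
    obtain ⟨c, hc⟩ := Ideal.Quotient.mk_surjective (I := I ^ 2)
      (Ideal.Quotient.mk (I ^ 2) a - σ (Ideal.Quotient.mk I a))
    have : c ∈ I := by
      rw [← Ideal.Quotient.eq_zero_iff_mem, ← hq, hc, map_sub, hσ, hq, sub_self]
    obtain ⟨b, rfl⟩ := Ideal.mem_span_singleton'.1 this
    exact ⟨b, by rw [mul_comm, hc]⟩
  -- Since `g` is a nonzerodivisor, `b` is determined modulo `g`, and `φ g = 0`.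
  have huniq : ∀ b b' : A, Ideal.Quotient.mk (I ^ 2) (g * b) = Ideal.Quotient.mk (I ^ 2) (g * b') →
      φ b = φ b' := by
    intro b b' h
    rw [Ideal.Quotient.eq, hI, Ideal.span_singleton_pow, Ideal.mem_span_singleton'] at h
    obtain ⟨c, hc⟩ := h
    have : b - b' = c * g := by
      apply mul_left_cancel₀ hg
      rw [mul_sub, ← hc]
      ring
    rw [← sub_eq_zero, ← map_sub, this, map_mul, hφg, mul_zero]
  choose b hb using hex
  -- The error term in the Leibniz rule is a product of two elements of `I / I²`.
  have hsq : ∀ x y : A, Ideal.Quotient.mk (I ^ 2) (g * x) * Ideal.Quotient.mk (I ^ 2) (g * y) = 0 := by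
    intro x y
    rw [← map_mul, Ideal.Quotient.eq_zero_iff_mem, hI, Ideal.span_singleton_pow,
      Ideal.mem_span_singleton']
    exact ⟨x * y, by ring⟩
  let ψ := tangentOfDerivation φ (fun a => φ (b a))
    (by
      intro x y
      rw [← map_add]
      refine huniq _ _ ?_
      rw [mul_add, map_add, hb, hb, hb]
      simp only [map_add]
      ring)
    (by
      intro x y
      rw [← map_mul, ← map_mul, ← map_add]
      refine huniq _ _ ?_
      have h1 : g * (x * b y + y * b x) = x * (g * b y) + y * (g * b x) := by ring
      have h2 := hsq (b x) (b y)
      rw [hb, hb] at h2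
      rw [h1, map_add, map_mul _ x, map_mul _ y, hb, hb, hb]
      simp only [map_mul] at h2 ⊢
      linear_combination -h2)
    (by
      intro c
      rw [← map_zero φ]
      refine huniq _ _ ?_
      rw [hb, mul_zero, map_zero, sub_eq_zero]
      exact (σ.commutes c).symm)
  have h1 : (ψ g).snd = 1 := by
    rw [snd_tangentOfDerivation, ← map_one φ]
    refine huniq _ _ ?_
    rw [hb, mul_one, (Ideal.Quotient.eq_zero_iff_mem (I := I)).2 (Ideal.mem_span_singleton_self g),
      map_zero, sub_zero]
  rw [hsing ψ (isTangentAt_tangentOfDerivation _ _ _ _ _)] at h1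
  exact zero_ne_one h1

/-- On a standard smooth algebra, finitely many derivations detect singular points. -/
theorem exists_isSingularAt_iff [Algebra.IsStandardSmooth ℂ A] :
    ∃ (κ : Type) (_ : Finite κ) (d : κ → A →ₗ[ℂ] A), ∀ (g : A) (φ : A →ₐ[ℂ] ℂ),
      IsSingularAt g φ ↔ ∀ k, φ (d k g) = 0 := by
  obtain ⟨ι, σ, _, _, ⟨P⟩⟩ := ‹Algebra.IsStandardSmooth ℂ A›
  -- The differentials of the variables outside the Jacobian minor form a basis of the Kähler
  -- differentials; their coordinate functions give the derivations. The extra index `none` tests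
  -- the value of `g` itself.
  let K := ((Set.range P.map)ᶜ : Set ι)
  let D : K → Derivation ℂ A A := fun k =>
    (P.basisKaehler.coord k).compDer (KaehlerDifferential.D ℂ A)
  refine ⟨Option K, inferInstance,
    fun k => k.elim LinearMap.id fun k => (D k : A →ₗ[ℂ] A), fun g φ => ⟨fun h => ?_, fun h => ?_⟩⟩
  · rintro (_ | k)
    · exact h.apply_eq_zero
    · have := h (tangentOfDerivation φ (fun a => φ (D k a)) (by simp)
        (fun a b => by simp [(D k).leibniz]) (by simp)) (isTangentAt_tangentOfDerivation _ _ _ _ _)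
      have h2 := congrArg TrivSqZeroExt.snd this
      rw [snd_tangentOfDerivation] at h2
      exact h2
  · intro ψ hψ
    refine TrivSqZeroExt.ext ((hψ g).trans (h none)) ?_
    cases nonempty_fintype K
    -- With `A` acting on `ℂ` through `φ`, the `ε`-part of `ψ` is a derivation and factors through
    -- the Kähler differentials.
    let : Module A ℂ := Module.compHom ℂ (φ : A →+* ℂ)
    have hsm : ∀ (a : A) (c : ℂ), a • c = φ a * c := fun _ _ => rfl
    have : IsScalarTower ℂ A ℂ := ⟨fun x y z => by simp [hsm, mul_assoc]⟩
    let δ : Derivation ℂ A ℂ :=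
      { toFun := fun a => (ψ a).snd
        map_add' := fun a b => by simp
        map_smul' := fun c a => by simp
        map_one_eq_zero' := by simp
        leibniz' := fun a b => by
          simp [hsm, hψ a, hψ b, mul_comm] }
    change δ g = 0
    rw [← δ.liftKaehlerDifferential_comp_D, ← P.basisKaehler.sum_repr (KaehlerDifferential.D ℂ A g),
      map_sum]
    refine Finset.sum_eq_zero fun k _ => ?_
    rw [map_smul, hsm]
    have := h (some k)
    simp only [Option.elim] at this
    rw [show P.basisKaehler.repr (KaehlerDifferential.D ℂ A g) k = D k g from rfl]
    rw [show φ (D k g) = 0 from this, zero_mul]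

/-- An open set containing some closed point contains a basic open set of a nonzero polynomial,
which omits only its finitely many roots. Unions and complements preserve the alternative. -/
lemma finite_or_finite_compl_of_isConstructible {s : Set (PrimeSpectrum (Polynomial ℂ))}
    (hs : IsConstructible s) (pt : ℂ → PrimeSpectrum (Polynomial ℂ))
    (hpt : ∀ t p, p ∈ (pt t).asIdeal ↔ p.IsRoot t) :
    {t | pt t ∈ s}.Finite ∨ {t | pt t ∈ s}ᶜ.Finite := by
  induction hs using IsConstructible.empty_union_induction with
  | open_retrocompact U hU _ =>
    by_cases hne : {t | pt t ∈ U} = ∅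
    · left
      simp [hne]
    · right
      obtain ⟨t, ht⟩ := nonempty_iff_ne_empty.2 hne
      obtain ⟨_, ⟨p, rfl⟩, hp, hpU⟩ :=
        PrimeSpectrum.isTopologicalBasis_basic_opens.exists_subset_of_mem_open ht hU
      have hp0 : p ≠ 0 := by
        rintro rfl
        simp at hp
      refine (p.roots.toFinset.finite_toSet).subset fun u hu => ?_
      have : pt u ∉ PrimeSpectrum.basicOpen p := fun h => hu (hpU h)
      rw [PrimeSpectrum.mem_basicOpen, not_not, hpt] at this
      simpa [hp0] using this
  | union s _ t _ hs ht =>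
    have h : {u | pt u ∈ s ∪ t} = {u | pt u ∈ s} ∪ {u | pt u ∈ t} := rfl
    rw [h, compl_union]
    rcases hs with hs | hs
    · rcases ht with ht | ht
      · exact Or.inl (hs.union ht)
      · exact Or.inr (ht.subset inter_subset_right)
    · exact Or.inr (hs.subset inter_subset_left)
  | compl s _ hs =>
    have h : {u | pt u ∈ sᶜ} = {u | pt u ∈ s}ᶜ := rfl
    rw [h, compl_compl, or_comm]
    exact hs

/-- The values of a function on the complex points of an algebra of finite type form a finite or
cofinite set. -/
theorem finite_or_finite_compl_values [Algebra.FiniteType ℂ A] (b : A) :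
    (range fun φ : A →ₐ[ℂ] ℂ => φ b).Finite ∨ (range fun φ : A →ₐ[ℂ] ℂ => φ b)ᶜ.Finite := by
  let f : Polynomial ℂ →ₐ[ℂ] A := Polynomial.aeval b
  have hf : (f : Polynomial ℂ →+* A).FinitePresentation := by
    refine RingHom.FinitePresentation.of_finiteType.1 ?_
    refine RingHom.FiniteType.of_comp_finiteType (f := algebraMap ℂ (Polynomial ℂ)) ?_
    rw [show (f : Polynomial ℂ →+* A).comp (algebraMap ℂ (Polynomial ℂ)) = algebraMap ℂ A from
      f.comp_algebraMap]
    exact RingHom.finiteType_algebraMap.2 inferInstance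
  have hmax : ∀ t : ℂ, (Ideal.span {Polynomial.X - Polynomial.C t}).IsMaximal := fun t =>
    PrincipalIdealRing.isMaximal_of_irreducible (Polynomial.irreducible_X_sub_C t)
  let pt : ℂ → PrimeSpectrum (Polynomial ℂ) := fun t => ⟨_, (hmax t).isPrime⟩
  have hpt : ∀ t p, p ∈ (pt t).asIdeal ↔ p.IsRoot t := fun t p =>
    Ideal.mem_span_singleton.trans Polynomial.dvd_iff_isRoot
  -- Chevalley's theorem for the map `Spec A → 𝔸¹` defined by `b`.
  have key := finite_or_finite_compl_of_isConstructible
    (PrimeSpectrum.isConstructible_range_comap hf) pt hpt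
  have : {t | pt t ∈ range (PrimeSpectrum.comap (f : Polynomial ℂ →+* A))} =
      range fun φ : A →ₐ[ℂ] ℂ => φ b := by
    ext t
    constructor
    · rintro ⟨Q, hQ⟩
      -- A maximal ideal above `Q` still contains `b - t`, and by the Nullstellensatz its residue
      -- field is `ℂ`.
      obtain ⟨m, hm, hQm⟩ := Ideal.exists_le_maximal Q.asIdeal Q.2.ne_top
      let := Ideal.Quotient.field m
      have := finite_of_finite_type_of_isJacobsonRing ℂ (A ⧸ m)
      let e : ℂ ≃ₐ[ℂ] A ⧸ m := AlgEquiv.ofBijective (Algebra.ofId ℂ (A ⧸ m))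
        (IsAlgClosed.algebraMap_bijective_of_isIntegral (k := ℂ))
      refine ⟨e.symm.toAlgHom.comp (Ideal.Quotient.mkₐ ℂ m), ?_⟩
      have hmem : (Polynomial.X - Polynomial.C t) ∈ (pt t).asIdeal := by
        rw [hpt]
        simp
      rw [← hQ, PrimeSpectrum.comap_asIdeal, Ideal.mem_comap] at hmem
      have h0 := (Ideal.Quotient.eq_zero_iff_mem (I := m)).2 (hQm hmem)
      simp only [f, RingHom.coe_coe, map_sub, Polynomial.aeval_X, Polynomial.aeval_C,
        sub_eq_zero] at h0
      change e.symm (Ideal.Quotient.mk m b) = t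
      rw [h0, AlgEquiv.symm_apply_eq]
      rfl
    · rintro ⟨φ, rfl⟩
      refine ⟨⟨RingHom.ker φ, RingHom.ker_isPrime _⟩, ?_⟩
      ext p
      rw [hpt, PrimeSpectrum.comap_asIdeal, Ideal.mem_comap, RingHom.mem_ker, RingHom.coe_coe]
      change φ (Polynomial.aeval b p) = 0 ↔ _
      rw [← Polynomial.aeval_algHom_apply, Polynomial.coe_aeval_eq_eval]
      rfl
  rwa [this] at key

/-- The pairs of a point and a parameter singular there are the complex points of a quotient of
`A[T]`, because the detecting maps `d k` are linear and so send the pencil to a pencil. The singular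
parameters are the values of `T` on it. -/
theorem finite_or_finite_compl_singularValues [Algebra.IsStandardSmooth ℂ A] (g₀ g₁ : A) :
    {t | ∃ φ : A →ₐ[ℂ] ℂ, IsSingularAt (pencil g₀ g₁ t) φ}.Finite ∨
      {t | ∃ φ : A →ₐ[ℂ] ℂ, IsSingularAt (pencil g₀ g₁ t) φ}ᶜ.Finite := by
  obtain ⟨κ, _, d, hd⟩ := exists_isSingularAt_iff (A := A)
  let rel : κ → Polynomial A := fun k =>
    (1 - Polynomial.X) * Polynomial.C (d k g₀) + Polynomial.X * Polynomial.C (d k g₁)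
  let I : Ideal (Polynomial A) := Ideal.span (range rel)
  have : Algebra.FiniteType ℂ A := inferInstance
  have : Algebra.FiniteType ℂ (Polynomial A) := Algebra.FiniteType.trans (S := A) this inferInstance
  have key := finite_or_finite_compl_values (A := Polynomial A ⧸ I)
    (Ideal.Quotient.mk I Polynomial.X)
  have heq : {t | ∃ φ : A →ₐ[ℂ] ℂ, IsSingularAt (pencil g₀ g₁ t) φ} =
      range fun φ : (Polynomial A ⧸ I) →ₐ[ℂ] ℂ => φ (Ideal.Quotient.mk I Polynomial.X) := by
    ext t
    constructor
    · rintro ⟨φ, hφ⟩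
      rw [hd] at hφ
      let χ : Polynomial A →ₐ[ℂ] ℂ :=
        { Polynomial.eval₂RingHom (φ : A →+* ℂ) t with
          commutes' := fun c => by simp [Polynomial.algebraMap_apply] }
      have hχC : ∀ a, χ (Polynomial.C a) = φ a := fun a => Polynomial.eval₂_C (φ : A →+* ℂ) t
      have hχX : χ Polynomial.X = t := Polynomial.eval₂_X (φ : A →+* ℂ) t
      refine ⟨Ideal.Quotient.liftₐ I χ ?_, hχX⟩
      intro x hx
      have hle : I ≤ RingHom.ker χ := by
        rw [Ideal.span_le]
        rintro _ ⟨k, rfl⟩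
        have := hφ k
        simp only [pencil, map_add, map_smul, smul_eq_mul] at this
        simp only [SetLike.mem_coe, RingHom.mem_ker, rel, map_add, map_mul, map_sub, map_one, hχC,
          hχX, this]
      exact hle hx
    · rintro ⟨χ, rfl⟩
      let φ : A →ₐ[ℂ] ℂ := (χ.comp (Ideal.Quotient.mkₐ ℂ I)).comp
        (IsScalarTower.toAlgHom ℂ A (Polynomial A))
      have hφ : ∀ a, φ a = χ (Ideal.Quotient.mk I (Polynomial.C a)) := fun a => rfl
      refine ⟨φ, (hd _ _).2 fun k => ?_⟩
      have h0 := congrArg χ ((Ideal.Quotient.eq_zero_iff_mem (I := I)).2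
        (Ideal.subset_span ⟨k, rfl⟩ : rel k ∈ I))
      simp only [rel, map_add, map_mul, map_sub, map_one, ← hφ, map_zero] at h0
      simpa only [pencil, map_add, map_smul, smul_eq_mul] using h0
  rwa [heq]

theorem isClosed_isSingularAt [Algebra.IsStandardSmooth ℂ A] (g₀ g₁ : A) :
    IsClosed {q : (A →ₐ[ℂ] ℂ) × ℂ | IsSingularAt (pencil g₀ g₁ q.2) q.1} := by
  obtain ⟨κ, _, d, hd⟩ := exists_isSingularAt_iff (A := A)
  have : {q : (A →ₐ[ℂ] ℂ) × ℂ | IsSingularAt (pencil g₀ g₁ q.2) q.1} =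
      ⋂ k, {q | q.1 (pencil (d k g₀) (d k g₁) q.2) = 0} := by
    ext q
    simp [hd, pencil]
  rw [this]
  exact isClosed_iInter fun k => isClosed_singleton.preimage (continuous_pencil_apply _ _)

end Singular

/-! ### Points of schemes with values in algebras -/

section ValuedPoints

variable {X : Scheme.{0}} {R : Type} [CommRing R]

/-- The value of a section at an `R`-valued point. -/
def pull (v : Spec (CommRingCat.of R) ⟶ X) {U : X.Opens} (h : ⊤ ≤ v ⁻¹ᵁ U) : Γ(X, U) →+* R :=
  (v.appLE U ⊤ h ≫ (Scheme.ΓSpecIso (CommRingCat.of R)).hom).hom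

lemma pull_res (v : Spec (CommRingCat.of R) ⟶ X) {U V : X.Opens} (hVU : V ≤ U)
    (hV : ⊤ ≤ v ⁻¹ᵁ V) (hU : ⊤ ≤ v ⁻¹ᵁ U) (f : Γ(X, U)) :
    pull v hV (X.presheaf.map (homOfLE hVU).op f) = pull v hU f := by
  rw [pull, pull, ← v.map_appLE hV (homOfLE hVU).op]
  rfl

lemma le_preimage_top {Y : Scheme.{0}} (g : X ⟶ Y) (U : X.Opens) : U ≤ g ⁻¹ᵁ ⊤ := le_top

lemma isUnit_pull_iff (v : Spec (CommRingCat.of R) ⟶ X) {U : X.Opens} (hU : ⊤ ≤ v ⁻¹ᵁ U)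
    (f : Γ(X, U)) : IsUnit (pull v hU f) ↔ ⊤ ≤ v ⁻¹ᵁ X.basicOpen f := by
  have h1 : IsUnit (pull v hU f) ↔ IsUnit (v.appLE U ⊤ hU f) :=
    isUnit_map_iff (Scheme.ΓSpecIso (CommRingCat.of R)).commRingCatIsoToRingEquiv _
  constructor
  · intro h
    have h2 := Scheme.basicOpen_appLE v ⊤ U hU f
    rw [h1] at h
    rw [Scheme.basicOpen_of_isUnit _ h] at h2
    exact h2.le.trans inf_le_right
  · intro h
    rw [← pull_res v (X.basicOpen_le f) h hU f]
    exact (RingedSpace.isUnit_res_basicOpen X.toRingedSpace f).map (pull v h)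

lemma pull_comp {Y : Scheme.{0}} (v : Spec (CommRingCat.of R) ⟶ Y) (g : Y ⟶ X) {U : X.Opens}
    (h : ⊤ ≤ (v ≫ g) ⁻¹ᵁ U) (h' : ⊤ ≤ v ⁻¹ᵁ (g ⁻¹ᵁ U)) (f : Γ(X, U)) :
    pull (v ≫ g) h f = pull v h' (g.app U f) := by
  rw [pull, pull, Scheme.Hom.comp_appLE]
  rfl

lemma specMap_pull_fromSpec (v : Spec (CommRingCat.of R) ⟶ X) {U : X.Opens} (hU : IsAffineOpen U)
    (h : ⊤ ≤ v ⁻¹ᵁ U) : Spec.map (CommRingCat.ofHom (pull v h)) ≫ hU.fromSpec = v := by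
  have := IsAffineOpen.SpecMap_appLE_fromSpec v hU (isAffineOpen_top _) h
  rw [IsAffineOpen.fromSpec_top, Scheme.isoSpec_Spec_inv] at this
  rw [pull, CommRingCat.ofHom_hom, Spec.map_comp, Category.assoc, this, ← Spec.map_comp_assoc,
    Iso.inv_hom_id, Spec.map_id, Category.id_comp]

lemma top_le_preimage_specMap_fromSpec {U : X.Opens} (hU : IsAffineOpen U) (φ : Γ(X, U) →+* R) :
    ⊤ ≤ (Spec.map (CommRingCat.ofHom φ) ≫ hU.fromSpec) ⁻¹ᵁ U := by
  rw [Scheme.Hom.comp_preimage, hU.fromSpec_preimage_self]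
  exact le_rfl

lemma pull_specMap_fromSpec {U : X.Opens} (hU : IsAffineOpen U) (φ : Γ(X, U) →+* R) :
    pull (Spec.map (CommRingCat.ofHom φ) ≫ hU.fromSpec) (top_le_preimage_specMap_fromSpec hU φ)
      = φ := by
  have h := specMap_pull_fromSpec (Spec.map (CommRingCat.ofHom φ) ≫ hU.fromSpec) hU
    (top_le_preimage_specMap_fromSpec hU φ)
  rw [cancel_mono] at h
  exact congrArg CommRingCat.Hom.hom (Spec.map_injective h)

variable (p : X ⟶ SpecC)

/-- The algebra structure on the sections of a scheme over `ℂ`. -/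
abbrev sectionsAlgebra (U : X.Opens) : Algebra ℂ Γ(X, U) :=
  ((Scheme.ΓSpecIso (CommRingCat.of ℂ)).inv ≫ p.appLE ⊤ U (le_preimage_top p U)).hom.toAlgebra

variable [Algebra ℂ R]

lemma pull_algebraMap {v : Spec (CommRingCat.of R) ⟶ X}
    (hv : v ≫ p = Spec.map (CommRingCat.ofHom (algebraMap ℂ R))) {U : X.Opens}
    (h : ⊤ ≤ v ⁻¹ᵁ U) (c : ℂ) :
    letI := sectionsAlgebra p U
    pull v h (algebraMap ℂ Γ(X, U) c) = algebraMap ℂ R c := by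
  have : (Scheme.ΓSpecIso (CommRingCat.of ℂ)).inv ≫ p.appLE ⊤ U (le_preimage_top p U) ≫ v.appLE U ⊤ h ≫
      (Scheme.ΓSpecIso (CommRingCat.of R)).hom = CommRingCat.ofHom (algebraMap ℂ R) := by
    rw [Scheme.Hom.appLE_comp_appLE_assoc, Iso.inv_comp_eq, ← Scheme.ΓSpecIso_naturality]
    simp only [hv]
    congr 1
  exact congrArg (fun f => f.hom c) this

/-- An `R`-valued point over `ℂ` in `U` as an algebra homomorphism. -/
def pullAlgHom {v : Spec (CommRingCat.of R) ⟶ X}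
    (hv : v ≫ p = Spec.map (CommRingCat.ofHom (algebraMap ℂ R))) {U : X.Opens}
    (h : ⊤ ≤ v ⁻¹ᵁ U) :
    letI := sectionsAlgebra p U
    Γ(X, U) →ₐ[ℂ] R :=
  letI := sectionsAlgebra p U
  { pull v h with commutes' := pull_algebraMap p hv h }

lemma specMap_fromSpec_over {U : X.Opens} (hU : IsAffineOpen U) :
    letI := sectionsAlgebra p U
    ∀ φ : Γ(X, U) →ₐ[ℂ] R, (Spec.map (CommRingCat.ofHom (φ : Γ(X, U) →+* R)) ≫ hU.fromSpec) ≫ p =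
      Spec.map (CommRingCat.ofHom (algebraMap ℂ R)) := by
  let := sectionsAlgebra p U
  intro φ
  have h := IsAffineOpen.SpecMap_appLE_fromSpec p (isAffineOpen_top SpecC) hU (le_preimage_top p U)
  rw [IsAffineOpen.fromSpec_top, Scheme.isoSpec_Spec_inv, ← Spec.map_comp] at h
  rw [Category.assoc, ← h, ← Spec.map_comp]
  congr 1
  ext c
  exact φ.commutes c

end ValuedPoints

/-! ### The classical topology in affine charts -/

section Charts

open Topology Set

variable {X : Scheme.{0}} (p : X ⟶ SpecC)

/-- The complex points of a scheme over `ℂ`, as morphisms `Spec ℂ ⟶ X`. -/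
abbrev Pts : Type := Points (Over.mk p)

variable {p}

/-- The morphism underlying a complex point. -/
def Pts.hom (x : Pts p) : SpecC ⟶ X := CommaMorphism.left x

lemma Pts.over (x : Pts p) :
    x.hom ≫ p = Spec.map (CommRingCat.ofHom (algebraMap ℂ ℂ)) := by
  have := Over.w x
  refine this.trans ?_
  simp only [Over.mk_hom]
  exact (Spec.map_id _).symm

/-- The complex point given by a section of the structure morphism. -/
def Pts.mk (v : SpecC ⟶ X) (hv : v ≫ p = Spec.map (CommRingCat.ofHom (algebraMap ℂ ℂ))) : Pts p :=
  Over.homMk v (by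
    refine hv.trans ?_
    exact Spec.map_id _)

lemma Pts.ext {x y : Pts p} (h : x.hom = y.hom) : x = y :=
  Over.OverMorphism.ext h

/-- The point of the scheme underlying a complex point. -/
def Pts.pt (x : Pts p) : X := x.hom (IsLocalRing.closedPoint ℂ)

lemma top_le_preimage_iff {R : Type} [CommRing R] [IsLocalRing R]
    (v : Spec (CommRingCat.of R) ⟶ X) (U : X.Opens) :
    ⊤ ≤ v ⁻¹ᵁ U ↔ v (IsLocalRing.closedPoint R) ∈ U := by
  constructor
  · intro h
    exact h trivial
  · intro h
    exact (IsLocalRing.closedPoint_mem_iff (v ⁻¹ᵁ U)).1 h |>.ge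

lemma Pts.mem_iff (x : Pts p) (U : X.Opens) : ⊤ ≤ x.hom ⁻¹ᵁ U ↔ x.pt ∈ U :=
  top_le_preimage_iff x.hom U

/-- Evaluation of sections at a complex point. -/
def Pts.eval (x : Pts p) {U : X.Opens} (h : x.pt ∈ U) : Γ(X, U) →+* ℂ :=
  pull x.hom ((x.mem_iff U).2 h)

lemma Pts.mem_basicSet (x : Pts p) (U : X.Opens) (f : Γ(X, U)) (V : Set ℂ) :
    x ∈ Points.basicSet (X := Over.mk p) U f V ↔ ∃ h : x.pt ∈ U, x.eval h f ∈ V :=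
  ⟨fun ⟨h, hf⟩ => ⟨(x.mem_iff U).1 h, hf⟩, fun ⟨h, hf⟩ => ⟨(x.mem_iff U).2 h, hf⟩⟩

lemma Pts.isOpen_eval (U : X.Opens) (f : Γ(X, U)) {V : Set ℂ} (hV : IsOpen V) :
    IsOpen {x : Pts p | ∃ h : x.pt ∈ U, x.eval h f ∈ V} := by
  have : {x : Pts p | ∃ h : x.pt ∈ U, x.eval h f ∈ V} = Points.basicSet (X := Over.mk p) U f V := by
    ext x
    exact (x.mem_basicSet U f V).symm
  rw [this]
  exact TopologicalSpace.isOpen_generateFrom_of_mem ⟨U, f, V, hV, rfl⟩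

lemma Pts.isOpen_mem (U : X.Opens) : IsOpen {x : Pts p | x.pt ∈ U} := by
  convert Pts.isOpen_eval (p := p) U 0 isOpen_univ using 2
  simp

lemma Pts.eval_res (x : Pts p) {U V : X.Opens} (hVU : V ≤ U) (hV : x.pt ∈ V) (f : Γ(X, U)) :
    x.eval hV (X.presheaf.map (homOfLE hVU).op f) = x.eval (hVU hV) f :=
  pull_res x.hom hVU _ _ f

lemma Pts.mem_basicOpen_iff (x : Pts p) {U : X.Opens} (h : x.pt ∈ U) (f : Γ(X, U)) :
    x.pt ∈ X.basicOpen f ↔ x.eval h f ≠ 0 := by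
  rw [← Pts.mem_iff, ← isUnit_pull_iff x.hom ((x.mem_iff U).2 h), isUnit_iff_ne_zero]
  rfl

/-- The complex point of an affine open given by an algebra homomorphism. -/
def chartPoint {U : X.Opens} (hU : IsAffineOpen U) :
    letI := sectionsAlgebra p U
    (Γ(X, U) →ₐ[ℂ] ℂ) → Pts p :=
  letI := sectionsAlgebra p U
  fun φ => Pts.mk (Spec.map (CommRingCat.ofHom (φ : Γ(X, U) →+* ℂ)) ≫ hU.fromSpec)
    (specMap_fromSpec_over p hU φ)

lemma chartPoint_mem {U : X.Opens} (hU : IsAffineOpen U) :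
    letI := sectionsAlgebra p U
    ∀ φ : Γ(X, U) →ₐ[ℂ] ℂ, (chartPoint (p := p) hU φ).pt ∈ U := by
  let := sectionsAlgebra p U
  intro φ
  rw [← Pts.mem_iff]
  exact top_le_preimage_specMap_fromSpec hU (φ : Γ(X, U) →+* ℂ)

lemma eval_chartPoint {U : X.Opens} (hU : IsAffineOpen U) :
    letI := sectionsAlgebra p U
    ∀ (φ : Γ(X, U) →ₐ[ℂ] ℂ) (h : (chartPoint (p := p) hU φ).pt ∈ U) (f : Γ(X, U)),
      (chartPoint (p := p) hU φ).eval h f = φ f := by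
  let := sectionsAlgebra p U
  intro φ h f
  exact congrFun (congrArg DFunLike.coe (pull_specMap_fromSpec hU (φ : Γ(X, U) →+* ℂ))) f

/-- The algebra homomorphism given by a complex point. -/
def Pts.evalAlgHom (x : Pts p) {U : X.Opens} (h : x.pt ∈ U) :
    letI := sectionsAlgebra p U
    Γ(X, U) →ₐ[ℂ] ℂ :=
  pullAlgHom p x.over ((x.mem_iff U).2 h)

lemma Pts.evalAlgHom_apply (x : Pts p) {U : X.Opens} (h : x.pt ∈ U) (f : Γ(X, U)) :
    letI := sectionsAlgebra p U
    x.evalAlgHom h f = x.eval h f := rfl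

lemma chartPoint_evalAlgHom {U : X.Opens} (hU : IsAffineOpen U) (x : Pts p) (h : x.pt ∈ U) :
    chartPoint hU (x.evalAlgHom h) = x := by
  refine Pts.ext ?_
  exact specMap_pull_fromSpec x.hom hU ((x.mem_iff U).2 h)

lemma range_chartPoint {U : X.Opens} (hU : IsAffineOpen U) :
    range (chartPoint (p := p) hU) = {x | x.pt ∈ U} := by
  ext x
  exact ⟨fun ⟨φ, hφ⟩ => hφ ▸ chartPoint_mem hU φ, fun h => ⟨_, chartPoint_evalAlgHom hU x h⟩⟩

lemma chartPoint_injective {U : X.Opens} (hU : IsAffineOpen U) :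
    Function.Injective (chartPoint (p := p) hU) := by
  let := sectionsAlgebra p U
  intro φ ψ h
  ext f
  rw [← eval_chartPoint hU φ (chartPoint_mem hU φ), ← eval_chartPoint hU ψ (chartPoint_mem hU ψ)]
  simp only [h]

/-- The classical topology tests sections over all opens `U'`, not only over `U`. Near a point of `U
∩ U'` such a section is a fraction `a / h ^ n` with `a`, `h` on `U`, whose value is continuous. -/
lemma continuous_chartPoint {U : X.Opens} (hU : IsAffineOpen U) :
    letI := sectionsAlgebra p U
    Continuous (chartPoint (p := p) hU) := by
  let := sectionsAlgebra p U
  refine continuous_generateFrom_iff.2 ?_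
  rintro _ ⟨U', f, V, hV, rfl⟩
  rw [isOpen_iff_mem_nhds]
  intro φ₀ hφ₀
  rw [mem_preimage, Pts.mem_basicSet] at hφ₀
  obtain ⟨h₀, hf₀⟩ := hφ₀
  obtain ⟨h, hle, hmem⟩ := hU.exists_basicOpen_le ⟨_, h₀⟩ (chartPoint_mem hU φ₀)
  have hloc : IsLocalization.Away h Γ(X, X.basicOpen h) := hU.isLocalization_basicOpen h
  obtain ⟨⟨a, ⟨_, n, rfl⟩⟩, ha⟩ := IsLocalization.surj (Submonoid.powers h)
    (X.presheaf.map (homOfLE hle).op f : Γ(X, X.basicOpen h))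
  have hval : ∀ (φ : Γ(X, U) →ₐ[ℂ] ℂ) (hφ : φ h ≠ 0), ∃ hm : (chartPoint (p := p) hU φ).pt ∈ U',
      (chartPoint (p := p) hU φ).eval hm f = φ a / φ h ^ n := by
    intro φ hφ
    have hm : (chartPoint (p := p) hU φ).pt ∈ X.basicOpen h := by
      rw [Pts.mem_basicOpen_iff _ (chartPoint_mem hU φ), eval_chartPoint]
      exact hφ
    refine ⟨hle hm, ?_⟩
    have h2 := congrArg ((chartPoint (p := p) hU φ).eval hm) ha
    have hres : ∀ b : Γ(X, U), (chartPoint (p := p) hU φ).eval hm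
        (algebraMap Γ(X, U) Γ(X, X.basicOpen h) b) = φ b := by
      intro b
      rw [← eval_chartPoint hU φ (chartPoint_mem hU φ)]
      exact Pts.eval_res _ (X.basicOpen_le h) hm b
    rw [map_mul, Pts.eval_res, hres, hres, map_pow] at h2
    rw [eq_div_iff (pow_ne_zero n hφ), h2]
  have hne₀ : φ₀ h ≠ 0 := by
    rw [← eval_chartPoint hU φ₀ (chartPoint_mem hU φ₀), ← Pts.mem_basicOpen_iff]
    exact hmem
  have hcont : ContinuousAt (fun φ : Γ(X, U) →ₐ[ℂ] ℂ => φ a / φ h ^ n) φ₀ :=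
    (continuous_affinePoints_apply a).continuousAt.div
      ((continuous_affinePoints_apply h).continuousAt.pow n) (pow_ne_zero n hne₀)
  have hV₀ : φ₀ a / φ₀ h ^ n ∈ V := by
    obtain ⟨hm, h3⟩ := hval φ₀ hne₀
    rwa [← h3]
  filter_upwards [hcont.preimage_mem_nhds (hV.mem_nhds hV₀),
    (continuous_affinePoints_apply h).continuousAt.eventually_ne hne₀] with φ hφV hφ
  rw [mem_preimage, Pts.mem_basicSet]
  obtain ⟨hm, h3⟩ := hval φ hφ
  exact ⟨hm, by rw [h3]; exact hφV⟩

/-- Affine charts are open embeddings for the classical topology. -/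
theorem isOpenEmbedding_chartPoint {U : X.Opens} (hU : IsAffineOpen U) :
    letI := sectionsAlgebra p U
    IsOpenEmbedding (chartPoint (p := p) hU) := by
  let := sectionsAlgebra p U
  refine ⟨⟨⟨le_antisymm (continuous_chartPoint hU).le_induced ?_⟩, chartPoint_injective hU⟩, ?_⟩
  · let T : TopologicalSpace (Γ(X, U) →ₐ[ℂ] ℂ) :=
      TopologicalSpace.induced (chartPoint (p := p) hU) inferInstance
    refine (@continuous_iff_le_induced _ _ _ T _).1 ((@continuous_pi_iff _ _ _ T _ _).2 fun f => ?_)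
    refine (@continuous_def _ _ T _ _).2 fun V hV => ?_
    refine isOpen_induced_iff.2 ⟨_, Pts.isOpen_eval (p := p) U f hV, ?_⟩
    ext φ
    simp only [mem_preimage, mem_ofPred_eq]
    constructor
    · rintro ⟨h, hf⟩
      rwa [eval_chartPoint] at hf
    · intro h
      exact ⟨chartPoint_mem hU φ, by rwa [eval_chartPoint]⟩
  · rw [range_chartPoint]
    exact Pts.isOpen_mem U

end Charts

/-! ### Complex points of closed subschemes -/

section ClosedSubschemes

open Topology Set

variable {X Y : Scheme.{0}} {p : X ⟶ SpecC}

/-- The map on complex points induced by a morphism. -/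
def Pts.push (i : Y ⟶ X) (y : Pts (i ≫ p)) : Pts p :=
  Pts.mk (y.hom ≫ i) (by rw [Category.assoc]; exact y.over)

lemma Pts.push_hom (i : Y ⟶ X) (y : Pts (i ≫ p)) : (y.push i).hom = y.hom ≫ i := rfl

lemma Pts.push_pt (i : Y ⟶ X) (y : Pts (i ≫ p)) : (y.push i).pt = i y.pt := by
  exact Scheme.Hom.comp_apply y.hom i _

lemma Pts.eval_push (i : Y ⟶ X) (y : Pts (i ≫ p)) {U : X.Opens} (h : (y.push i).pt ∈ U)
    (h' : y.pt ∈ i ⁻¹ᵁ U) (f : Γ(X, U)) : (y.push i).eval h f = y.eval h' (i.app U f) :=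
  pull_comp y.hom i _ _ f

lemma Pts.continuous_push (i : Y ⟶ X) : Continuous (Pts.push (p := p) i) :=
  Points.continuous_map (Over.homMk i : Over.mk (i ≫ p) ⟶ Over.mk p)

/-- A closed immersion induces an embedding on complex points. -/
theorem Pts.isEmbedding_push (i : Y ⟶ X) [IsClosedImmersion i] :
    IsEmbedding (Pts.push (p := p) i) := by
  refine ⟨⟨le_antisymm (Pts.continuous_push i).le_induced (le_generateFrom ?_)⟩, ?_⟩
  · rintro _ ⟨U', f, V, hV, rfl⟩
    let T : TopologicalSpace (Pts (i ≫ p)) :=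
      TopologicalSpace.induced (Pts.push (p := p) i) inferInstance
    refine (@isOpen_iff_forall_mem_open _ T _).2 fun y hy => ?_
    rw [Pts.mem_basicSet (p := i ≫ p)] at hy
    obtain ⟨hyU', hyV⟩ := hy
    obtain ⟨_, ⟨U, hU, rfl⟩, hyU, -⟩ :=
      X.isBasis_affineOpens.exists_subset_of_mem_open (mem_univ (i y.pt)) isOpen_univ
    have hU : IsAffineOpen U := hU
    obtain ⟨h, hle, hyh⟩ := (hU.preimage i).exists_basicOpen_le ⟨y.pt, hyU'⟩ hyU
    -- Over affine opens sections of `Y` lift to `X`: lifting first `h`, then the restriction of `f`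
    -- to the basic open, replaces a subbasic condition on `Y` by one on `X`.
    obtain ⟨h, rfl⟩ := i.app_surjective U hU h
    rw [← Scheme.preimage_basicOpen] at hle hyh
    obtain ⟨f', hf'⟩ := i.app_surjective (X.basicOpen h) (hU.basicOpen h)
      (Y.presheaf.map (homOfLE hle).op f)
    have hval : ∀ (z : Pts (i ≫ p)) (hz : z.pt ∈ i ⁻¹ᵁ X.basicOpen h)
        (hz' : (z.push i).pt ∈ X.basicOpen h), (z.push i).eval hz' f' = z.eval (hle hz) f := by
      intro z hz hz'
      rw [Pts.eval_push i z hz' hz, hf', Pts.eval_res]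
    refine ⟨Pts.push (p := p) i ⁻¹' {x | ∃ hx : x.pt ∈ X.basicOpen h, x.eval hx f' ∈ V}, ?_, ?_, ?_⟩
    · rintro z ⟨hz, hzV⟩
      rw [Pts.mem_basicSet (p := i ≫ p)]
      have hz2 : z.pt ∈ i ⁻¹ᵁ X.basicOpen h := by
        rw [Pts.push_pt] at hz
        exact hz
      exact ⟨hle hz2, by rwa [hval z hz2] at hzV⟩
    · exact isOpen_induced_iff.2 ⟨_, Pts.isOpen_eval (p := p) _ f' hV, rfl⟩
    · have hy2 : (y.push i).pt ∈ X.basicOpen h := by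
        rw [Pts.push_pt]
        exact hyh
      exact ⟨hy2, by rwa [hval y hyh hy2]⟩
  · intro y z h
    refine Pts.ext ?_
    have := congrArg Pts.hom h
    rwa [Pts.push_hom, Pts.push_hom, cancel_mono] at this

lemma Pts.eval_eq_zero_of_push (D : X.IdealSheafData) (y : Pts (D.subschemeι ≫ p))
    (U : X.affineOpens) (h : (y.push D.subschemeι).pt ∈ U.1) {f : Γ(X, U.1)} (hf : f ∈ D.ideal U) :
    (y.push D.subschemeι).eval h f = 0 := by
  have h' : y.pt ∈ D.subschemeι ⁻¹ᵁ U.1 := by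
    rw [Pts.push_pt] at h
    exact h
  rw [Pts.eval_push D.subschemeι y h h']
  rw [← D.ker_subschemeι_app, RingHom.mem_ker] at hf
  rw [hf, map_zero]

/-- The complex points of a closed subscheme are those at which its equations vanish. -/
lemma Pts.exists_push_eq (D : X.IdealSheafData) (x : Pts p) (U : X.affineOpens) (h : x.pt ∈ U.1)
    (hx : ∀ f ∈ D.ideal U, x.eval h f = 0) :
    ∃ y : Pts (D.subschemeι ≫ p), y.push D.subschemeι = x := by
  have hle : RingHom.ker (D.subschemeι.app U.1).hom ≤ RingHom.ker (x.eval h) := by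
    rw [D.ker_subschemeι_app]
    exact hx
  -- Evaluation at `x` kills the ideal of `D`, hence factors through the sections of `D`.
  let φ : Γ(D.subscheme, D.subschemeι ⁻¹ᵁ U.1) →+* ℂ :=
    (D.subschemeι.app U.1).hom.liftOfSurjective (D.subschemeι_app_surjective U) ⟨x.eval h, hle⟩
  have hφ : ∀ f, φ (D.subschemeι.app U.1 f) = x.eval h f := fun f =>
    RingHom.liftOfRightInverse_comp_apply (D.subschemeι.app U.1).hom _ _ ⟨x.eval h, hle⟩ f
  have hV : IsAffineOpen (D.subschemeι ⁻¹ᵁ U.1) := U.2.preimage D.subschemeι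
  let v : SpecC ⟶ D.subscheme := Spec.map (CommRingCat.ofHom φ) ≫ hV.fromSpec
  have hv : v ≫ D.subschemeι = x.hom := by
    have h1 := top_le_preimage_specMap_fromSpec hV φ
    rw [← specMap_pull_fromSpec (v ≫ D.subschemeι) U.2 h1,
      ← specMap_pull_fromSpec x.hom U.2 ((x.mem_iff U.1).2 h)]
    congr 3
    ext f
    rw [pull_comp v D.subschemeι h1 h1, show pull v h1 = φ from pull_specMap_fromSpec hV φ, hφ]
    rfl
  refine ⟨Pts.mk v ?_, Pts.ext hv⟩
  rw [← Category.assoc, hv]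
  exact x.over

lemma formallySmooth_quotient (D : X.IdealSheafData) (hD : Smooth (D.subschemeι ≫ p))
    (U : X.affineOpens) :
    letI := sectionsAlgebra p U.1
    Algebra.FormallySmooth ℂ (Γ(X, U.1) ⧸ D.ideal U) := by
  let := sectionsAlgebra p U.1
  have hV : IsAffineOpen (D.subschemeι ⁻¹ᵁ U.1) := U.2.preimage D.subschemeι
  have h := (D.subschemeι ≫ p).smooth_appLE (isAffineOpen_top SpecC) hV
    (le_preimage_top (D.subschemeι ≫ p) _)
  have h2 := (RingHom.FormallySmooth.of_bijective
    (Scheme.ΓSpecIso (CommRingCat.of ℂ)).symm.commRingCatIsoToRingEquiv.bijective).comp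
      (h.formallySmooth.comp (RingHom.FormallySmooth.of_bijective
        (D.subschemeObjIso U).commRingCatIsoToRingEquiv.bijective))
  rw [← RingHom.formallySmooth_algebraMap]
  convert h2 using 1
  have h3 : (D.subschemeι ≫ p).appLE ⊤ (D.subschemeι ⁻¹ᵁ U.1) (le_preimage_top _ _) =
      p.appLE ⊤ U.1 (le_preimage_top _ _) ≫ D.subschemeι.app U.1 := by
    rw [Scheme.Hom.app_eq_appLE, Scheme.Hom.appLE_comp_appLE]
  have h4 : (Scheme.ΓSpecIso (CommRingCat.of ℂ)).inv ≫
      (D.subschemeι ≫ p).appLE ⊤ (D.subschemeι ⁻¹ᵁ U.1) (le_preimage_top _ _) ≫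
        (D.subschemeObjIso U).hom = ((Scheme.ΓSpecIso (CommRingCat.of ℂ)).inv ≫
          p.appLE ⊤ U.1 (le_preimage_top _ _)) ≫
            CommRingCat.ofHom (Ideal.Quotient.mk (D.ideal U)) := by
    rw [h3, D.subschemeι_app]
    simp
  exact congrArg CommRingCat.Hom.hom h4.symm

end ClosedSubschemes

/-! ### Compactness of projective varieties in the classical topology -/

section StandardCharts

open Topology Set

variable {X Y : Scheme.{0}} {p : X ⟶ SpecC} {ι : Type}

/-- An affine open cover with ratios of homogeneous coordinates as for projective space: `y i k`
is to be thought of as the quotient of the `k`-th by the `i`-th coordinate. -/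
structure StandardCharts (p : X ⟶ SpecC) (ι : Type) where
  /-- The open set on which the `i`-th coordinate does not vanish. -/
  U : ι → X.Opens
  isAffineOpen : ∀ i, IsAffineOpen (U i)
  cover : ∀ x : X, ∃ i, x ∈ U i
  /-- The quotient of two coordinates. -/
  y : ∀ i, ι → Γ(X, U i)
  surjective : ∀ i, letI := sectionsAlgebra p (U i)
    Function.Surjective (MvPolynomial.aeval (R := ℂ) (y i))
  basicOpen_eq : ∀ i k, X.basicOpen (y i k) = U i ⊓ U k
  self : ∀ i, y i i = 1
  cocycle : ∀ i k l, X.presheaf.map (homOfLE (inf_le_left : U i ⊓ U k ≤ U i)).op (y i l) =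
    X.presheaf.map (homOfLE (inf_le_left : U i ⊓ U k ≤ U i)).op (y i k) *
      X.presheaf.map (homOfLE (inf_le_right : U i ⊓ U k ≤ U k)).op (y k l)

namespace StandardCharts

variable (C : StandardCharts p ι)

lemma eval_cocycle (x : Pts p) {i k : ι} (hi : x.pt ∈ C.U i) (hk : x.pt ∈ C.U k) (l : ι) :
    x.eval hi (C.y i l) = x.eval hi (C.y i k) * x.eval hk (C.y k l) := by
  have hik : x.pt ∈ C.U i ⊓ C.U k := ⟨hi, hk⟩
  have h := congrArg (x.eval hik) (C.cocycle i k l)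
  rwa [map_mul, Pts.eval_res, Pts.eval_res, Pts.eval_res] at h

lemma mem_iff (x : Pts p) {i : ι} (hi : x.pt ∈ C.U i) (k : ι) :
    x.pt ∈ C.U k ↔ x.eval hi (C.y i k) ≠ 0 := by
  rw [← Pts.mem_basicOpen_iff, C.basicOpen_eq]
  exact ⟨fun h => ⟨hi, h⟩, fun h => h.2⟩

lemma isCompact_polydisc [Finite ι] (i : ι) :
    letI := sectionsAlgebra p (C.U i)
    IsCompact {φ : Γ(X, C.U i) →ₐ[ℂ] ℂ | ∀ k, ‖φ (C.y i k)‖ ≤ 1} := by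
  let := sectionsAlgebra p (C.U i)
  have : Fintype ι := Fintype.ofFinite ι
  have h := (isClosedEmbedding_coordinates (C.y i) (C.surjective i)).isCompact_preimage
    (isCompact_univ_pi fun _ : ι => isCompact_closedBall (0 : ℂ) 1)
  convert h using 1
  ext φ
  simp

-- Dividing by a coordinate of largest modulus puts every point into one of the finitely many
-- compact polydiscs `|y m k| ≤ 1`.
include C in
theorem compactSpace [Finite ι] : CompactSpace (Pts p) := by
  refine ⟨?_⟩
  have h : (univ : Set (Pts p)) = ⋃ i, (letI := sectionsAlgebra p (C.U i)
      chartPoint (p := p) (C.isAffineOpen i) ''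
        {φ : Γ(X, C.U i) →ₐ[ℂ] ℂ | ∀ k, ‖φ (C.y i k)‖ ≤ 1}) := by
    refine (eq_univ_of_forall fun x => ?_).symm
    obtain ⟨i, hi⟩ := C.cover x.pt
    have : Nonempty ι := ⟨i⟩
    obtain ⟨m, hm⟩ := Finite.exists_max fun k => ‖x.eval hi (C.y i k)‖
    -- The maximum is at least `1`, the modulus of `y i i`.
    have hpos : x.eval hi (C.y i m) ≠ 0 := by
      intro h0
      have := hm i
      rw [C.self, map_one, h0, norm_one, norm_zero] at this
      linarith
    have hxm : x.pt ∈ C.U m := (C.mem_iff x hi m).2 hpos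
    refine mem_iUnion.2 ⟨m, _, ?_, chartPoint_evalAlgHom (C.isAffineOpen m) x hxm⟩
    intro k
    rw [Pts.evalAlgHom_apply]
    have h2 := hm k
    rw [C.eval_cocycle x hi hxm k, norm_mul] at h2
    have h3 : 0 < ‖x.eval hi (C.y i m)‖ := norm_pos_iff.2 hpos
    exact (mul_le_iff_le_one_right h3).1 h2
  rw [h]
  exact isCompact_iUnion fun i =>
    (C.isCompact_polydisc i).image (isOpenEmbedding_chartPoint (C.isAffineOpen i)).continuous

/-- On the overlap `y i k * y k i = 1`, while `y i k` vanishes at `x`. So `|y i k| < 1/c` and `|y k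
i| < c` exclude each other, for any `c` above the modulus of `y k i` at `z`. -/
lemma separated_of_notMem {x z : Pts p} {i k : ι} (hi : x.pt ∈ C.U i) (hk : z.pt ∈ C.U k)
    (hx : x.pt ∉ C.U k) :
    ∃ u v : Set (Pts p), IsOpen u ∧ IsOpen v ∧ x ∈ u ∧ z ∈ v ∧ Disjoint u v := by
  have h0 : x.eval hi (C.y i k) = 0 := by
    by_contra h
    exact hx ((C.mem_iff x hi k).2 h)
  set c := ‖z.eval hk (C.y k i)‖ + 1 with hc
  have hcpos : 0 < c := by positivity
  refine ⟨_, _, Pts.isOpen_eval (p := p) (C.U i) (C.y i k) (Metric.isOpen_ball (x := 0) (ε := c⁻¹)),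
    Pts.isOpen_eval (p := p) (C.U k) (C.y k i) (Metric.isOpen_ball (x := 0) (ε := c)), ⟨hi, ?_⟩,
    ⟨hk, ?_⟩, ?_⟩
  · rw [h0]
    exact Metric.mem_ball_self (inv_pos.2 hcpos)
  · rw [mem_ball_zero_iff]
    linarith
  · rw [Set.disjoint_left]
    rintro w ⟨hwi, h1⟩ ⟨hwk, h2⟩
    rw [mem_ball_zero_iff] at h1 h2
    have h3 := congrArg norm (C.eval_cocycle w hwi hwk i)
    rw [C.self, map_one, norm_one, norm_mul] at h3
    have h4 : ‖w.eval hwi (C.y i k)‖ * ‖w.eval hwk (C.y k i)‖ < c⁻¹ * c :=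
      mul_lt_mul'' h1 h2 (norm_nonneg _) (norm_nonneg _)
    rw [inv_mul_cancel₀ hcpos.ne', ← h3] at h4
    exact lt_irrefl _ h4

include C in
theorem t2Space : T2Space (Pts p) := by
  refine ⟨fun x z hxz => ?_⟩
  obtain ⟨i, hi⟩ := C.cover x.pt
  by_cases hz : z.pt ∈ C.U i
  · let := sectionsAlgebra p (C.U i)
    have hemb := isOpenEmbedding_chartPoint (p := p) (C.isAffineOpen i)
    have hne : x.evalAlgHom hi ≠ z.evalAlgHom hz := by
      intro h
      apply hxz
      rw [← chartPoint_evalAlgHom (C.isAffineOpen i) x hi, h,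
        chartPoint_evalAlgHom (C.isAffineOpen i) z hz]
    obtain ⟨u, v, hu, hv, hxu, hzv, huv⟩ := t2_separation hne
    refine ⟨_, _, hemb.isOpenMap u hu, hemb.isOpenMap v hv,
      ⟨_, hxu, chartPoint_evalAlgHom (C.isAffineOpen i) x hi⟩,
      ⟨_, hzv, chartPoint_evalAlgHom (C.isAffineOpen i) z hz⟩, ?_⟩
    exact (disjoint_image_iff hemb.injective).2 huv
  · obtain ⟨k, hk⟩ := C.cover z.pt
    obtain ⟨u, v, hu, hv, hzu, hxv, huv⟩ := C.separated_of_notMem hk hi hz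
    exact ⟨v, u, hv, hu, hxv, hzu, huv.symm⟩

/-- The standard charts of a closed subscheme. -/
def pullback (j : Y ⟶ X) [IsClosedImmersion j] : StandardCharts (j ≫ p) ι where
  U i := j ⁻¹ᵁ C.U i
  isAffineOpen i := (C.isAffineOpen i).preimage j
  cover x := C.cover (j x)
  y i k := j.app (C.U i) (C.y i k)
  surjective i := by
    let := sectionsAlgebra p (C.U i)
    let := sectionsAlgebra (j ≫ p) (j ⁻¹ᵁ C.U i)
    intro b
    obtain ⟨a, rfl⟩ := j.app_surjective _ (C.isAffineOpen i) b
    obtain ⟨P, rfl⟩ := C.surjective i a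
    refine ⟨P, ?_⟩
    have halg : ∀ c : ℂ, algebraMap ℂ Γ(Y, j ⁻¹ᵁ C.U i) c =
        j.app (C.U i) (algebraMap ℂ Γ(X, C.U i) c) := by
      intro c
      have h3 : (j ≫ p).appLE ⊤ (j ⁻¹ᵁ C.U i) (le_preimage_top _ _) =
          p.appLE ⊤ (C.U i) (le_preimage_top _ _) ≫ j.app (C.U i) := by
        rw [Scheme.Hom.app_eq_appLE, Scheme.Hom.appLE_comp_appLE]
      exact congrArg (fun g => g.hom ((Scheme.ΓSpecIso (CommRingCat.of ℂ)).inv c)) h3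
    let J : Γ(X, C.U i) →ₐ[ℂ] Γ(Y, j ⁻¹ᵁ C.U i) :=
      { (j.app (C.U i)).hom with commutes' := fun c => (halg c).symm }
    exact (MvPolynomial.comp_aeval_apply (C.y i) J P).symm
  basicOpen_eq i k := by
    rw [← Scheme.preimage_basicOpen, C.basicOpen_eq]
    rfl
  self i := by rw [C.self, map_one]
  cocycle i k l := by
    have h := congrArg (j.app (C.U i ⊓ C.U k)) (C.cocycle i k l)
    have hn : ∀ (U V : X.Opens) (hVU : V ≤ U) (f : Γ(X, U)),
        j.app V (X.presheaf.map (homOfLE hVU).op f) =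
          Y.presheaf.map (homOfLE (fun _ hx => hVU hx : j ⁻¹ᵁ V ≤ j ⁻¹ᵁ U)).op (j.app U f) := by
      intro U V hVU f
      exact congrArg (fun g => g.hom f) (j.naturality (homOfLE hVU).op)
    rw [map_mul, hn, hn, hn] at h
    exact h

end StandardCharts

end StandardCharts

/-! ### The standard charts of projective space -/

section ProjectiveCharts

open HomogeneousLocalization

attribute [local instance] MvPolynomial.gradedAlgebra

/-- The homogeneous coordinate ring of projective space. -/
local notation "𝒜[" n "]" => MvPolynomial.homogeneousSubmodule (Fin (n + 1)) ℂ

variable {n : ℕ}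

lemma X_mem (i : Fin (n + 1)) : (MvPolynomial.X i : MvPolynomial (Fin (n + 1)) ℂ) ∈ 𝒜[n] 1 :=
  MvPolynomial.isHomogeneous_X ℂ i

lemma X_mem_smul (i : Fin (n + 1)) :
    (MvPolynomial.X i : MvPolynomial (Fin (n + 1)) ℂ) ∈ 𝒜[n] (1 • 1) :=
  MvPolynomial.isHomogeneous_X ℂ i

/-- The quotient of two coordinates in the homogeneous localization. -/
def coordinateRatio (i k : Fin (n + 1)) : Away 𝒜[n] (MvPolynomial.X i) :=
  Away.mk 𝒜[n] (X_mem i) 1 (MvPolynomial.X k) (X_mem_smul k)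

lemma coordinateRatio_eq_isLocalizationElem (i k : Fin (n + 1)) :
    coordinateRatio i k = Away.isLocalizationElem (𝒜 := 𝒜[n]) (X_mem i) (X_mem k) := by
  ext
  simp [coordinateRatio]

lemma coordinateRatio_self (i : Fin (n + 1)) : coordinateRatio i i = 1 := by
  ext
  rw [coordinateRatio, Away.val_mk, HomogeneousLocalization.val_one]
  rw [← Localization.mk_one, Localization.mk_eq_mk_iff, Localization.r_iff_exists]
  exact ⟨1, by simp⟩

lemma eval₂_mul_of_isHomogeneous {σ R S : Type*} [CommSemiring R] [CommSemiring S] (c : R →+* S)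
    (r : S) (s : σ → S) {P : MvPolynomial σ R} {d : ℕ} (hP : P.IsHomogeneous d) :
    P.eval₂ c (fun i => r * s i) = r ^ d * P.eval₂ c s := by
  rw [MvPolynomial.eval₂_eq, MvPolynomial.eval₂_eq, Finset.mul_sum]
  refine Finset.sum_congr rfl fun m hm => ?_
  have hd : ∑ i ∈ m.support, m i = d := by
    have := hP (MvPolynomial.mem_support_iff.1 hm)
    rw [← this]
    simp [Finsupp.weight_apply, Finsupp.sum]
  simp only [mul_pow]
  rw [Finset.prod_mul_distrib, Finset.prod_pow_eq_pow_sum, hd]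
  ring

/-- The inclusion of the constants into the homogeneous localization. -/
def awayConstants (i : Fin (n + 1)) : ℂ →+* Away 𝒜[n] (MvPolynomial.X i) :=
  (fromZeroRingHom 𝒜[n] _).comp (algebraMap ℂ (𝒜[n] 0))

/-- Dehomogenization, `P / X_i ^ d = P (X_0 / X_i, …, X_n / X_i)`; hence the ratios generate the
coordinate ring of the chart. -/
lemma mk_eq_eval₂_coordinateRatio (i : Fin (n + 1)) (d : ℕ) (P : MvPolynomial (Fin (n + 1)) ℂ)
    (hP : P ∈ 𝒜[n] (d • 1)) :
    Away.mk 𝒜[n] (X_mem i) d P hP = P.eval₂ (awayConstants i) (coordinateRatio i) := by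
  ext
  let L := Localization (Submonoid.powers (MvPolynomial.X i : MvPolynomial (Fin (n + 1)) ℂ))
  let V : Away 𝒜[n] (MvPolynomial.X i) →+* L := algebraMap _ _
  have hV : ∀ a, a.val = V a := fun a => rfl
  have hc : V.comp (awayConstants i) = (algebraMap (MvPolynomial (Fin (n + 1)) ℂ) L).comp
      MvPolynomial.C := by
    ext c
    exact Localization.mk_one_eq_algebraMap _
  have hX : ∀ k, algebraMap (MvPolynomial (Fin (n + 1)) ℂ) L (MvPolynomial.X k) =
      algebraMap (MvPolynomial (Fin (n + 1)) ℂ) L (MvPolynomial.X i) * V (coordinateRatio i k) := by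
    intro k
    rw [← hV, coordinateRatio, Away.val_mk, ← Localization.mk_one_eq_algebraMap,
      ← Localization.mk_one_eq_algebraMap, Localization.mk_mul, Localization.mk_eq_mk_iff,
      Localization.r_iff_exists]
    exact ⟨1, by simp⟩
  have hP' : P.IsHomogeneous d := by
    rw [smul_eq_mul, mul_one] at hP
    exact hP
  have h1 : algebraMap _ L P = P.eval₂ (V.comp (awayConstants i))
      (fun k => algebraMap (MvPolynomial (Fin (n + 1)) ℂ) L (MvPolynomial.X i) * V (coordinateRatio i k)) := by
    conv_lhs => rw [← MvPolynomial.eval₂_eta P, MvPolynomial.hom_eval₂]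
    rw [hc]
    congr 1
    funext k
    exact hX k
  rw [eval₂_mul_of_isHomogeneous _ _ _ hP'] at h1
  rw [hV (P.eval₂ _ _), MvPolynomial.hom_eval₂, Away.val_mk, Localization.mk_eq_mk'_apply,
    IsLocalization.mk'_eq_iff_eq_mul, mul_comm, h1, map_pow]

lemma surjective_eval₂_coordinateRatio (i : Fin (n + 1)) :
    Function.Surjective (MvPolynomial.eval₂ (awayConstants i) (coordinateRatio i)) := by
  intro a
  obtain ⟨d, P, hP, rfl⟩ := Away.mk_surjective 𝒜[n] (X_mem i) a
  exact ⟨P, (mk_eq_eval₂_coordinateRatio i d P hP).symm⟩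

lemma isAffineOpen_basicOpen_X (i : Fin (n + 1)) :
    IsAffineOpen (Proj.basicOpen 𝒜[n] (MvPolynomial.X i)) :=
  Proj.isAffineOpen_basicOpen 𝒜[n] _ (X_mem i) Nat.one_pos

lemma awayι_eq (i : Fin (n + 1)) :
    Spec.map (Proj.awayToSection 𝒜[n] (MvPolynomial.X i)) ≫
      Proj.awayι 𝒜[n] (MvPolynomial.X i) (X_mem i) Nat.one_pos =
        (isAffineOpen_basicOpen_X i).fromSpec := by
  have h : Proj.basicOpenToSpec 𝒜[n] (MvPolynomial.X i) ≫
      Proj.awayι 𝒜[n] (MvPolynomial.X i) (X_mem i) Nat.one_pos =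
        (Proj.basicOpen 𝒜[n] (MvPolynomial.X i)).ι := by
    rw [Proj.awayι, ← Proj.basicOpenIsoSpec_hom 𝒜[n] _ (X_mem i) Nat.one_pos,
      Iso.hom_inv_id_assoc]
  rw [Proj.basicOpenToSpec, Category.assoc] at h
  rw [← cancel_epi (isAffineOpen_basicOpen_X i).isoSpec.hom]
  rw [IsAffineOpen.fromSpec, Iso.hom_inv_id_assoc, IsAffineOpen.isoSpec_hom]
  exact h

/-- The value of the structure map of projective space on constants. -/
lemma awayToSection_awayConstants (i : Fin (n + 1)) (c : ℂ) :
    letI := sectionsAlgebra (ProjectiveSpace.toSpecC n) (Proj.basicOpen 𝒜[n] (MvPolynomial.X i))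
    algebraMap ℂ Γ(ProjectiveSpace n, Proj.basicOpen 𝒜[n] (MvPolynomial.X i)) c =
      Proj.awayToSection 𝒜[n] (MvPolynomial.X i) (awayConstants i c) := by
  have h := IsAffineOpen.SpecMap_appLE_fromSpec (ProjectiveSpace.toSpecC n)
    (isAffineOpen_top SpecC) (isAffineOpen_basicOpen_X i) (le_preimage_top _ _)
  rw [IsAffineOpen.fromSpec_top, Scheme.isoSpec_Spec_inv, ← Spec.map_comp, ← awayι_eq,
    ProjectiveSpace.toSpecC, Category.assoc, Proj.awayι_toSpecZero_assoc, ← Spec.map_comp,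
    ← Spec.map_comp] at h
  exact congrArg (fun g => g.hom c) (Spec.map_injective h)

lemma basicOpen_awayToSection (i k : Fin (n + 1)) :
    (ProjectiveSpace n).basicOpen (Proj.awayToSection 𝒜[n] (MvPolynomial.X i)
      (coordinateRatio i k)) = Proj.basicOpen 𝒜[n] (MvPolynomial.X i) ⊓
        Proj.basicOpen 𝒜[n] (MvPolynomial.X k) := by
  have hU := isAffineOpen_basicOpen_X i
  have h1 := Proj.awayι_preimage_basicOpen 𝒜[n] (X_mem i) Nat.one_pos (X_mem k) Nat.one_pos
  rw [← coordinateRatio_eq_isLocalizationElem] at h1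
  have h2 : hU.fromSpec ⁻¹ᵁ Proj.basicOpen 𝒜[n] (MvPolynomial.X k) =
      hU.fromSpec ⁻¹ᵁ (ProjectiveSpace n).basicOpen
        (Proj.awayToSection 𝒜[n] (MvPolynomial.X i) (coordinateRatio i k)) := by
    rw [hU.fromSpec_preimage_basicOpen, ← awayι_eq, Scheme.Hom.comp_preimage, h1]
    rfl
  ext x
  constructor
  · intro hx
    have hxU := (ProjectiveSpace n).basicOpen_le _ hx
    refine ⟨hxU, ?_⟩
    rw [← hU.opensRange_fromSpec] at hxU
    obtain ⟨z, rfl⟩ := hxU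
    have : z ∈ hU.fromSpec ⁻¹ᵁ Proj.basicOpen 𝒜[n] (MvPolynomial.X k) := by
      rw [h2]
      exact hx
    exact this
  · rintro ⟨hxU, hx⟩
    rw [SetLike.mem_coe, ← hU.opensRange_fromSpec] at hxU
    obtain ⟨z, rfl⟩ := hxU
    have : z ∈ hU.fromSpec ⁻¹ᵁ (ProjectiveSpace n).basicOpen
        (Proj.awayToSection 𝒜[n] (MvPolynomial.X i) (coordinateRatio i k)) := by
      rw [← h2]
      exact hx
    exact this

lemma awayMap_coordinateRatio (i k l : Fin (n + 1)) :
    awayMap 𝒜[n] (X_mem k) (rfl : MvPolynomial.X i * MvPolynomial.X k = _) (coordinateRatio i l) =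
      awayMap 𝒜[n] (X_mem k) rfl (coordinateRatio i k) *
        awayMap 𝒜[n] (X_mem i) (mul_comm _ _) (coordinateRatio k l) := by
  ext
  simp only [coordinateRatio, awayMap_mk, Away.val_mk, HomogeneousLocalization.val_mul,
    Localization.mk_mul]
  rw [Localization.mk_eq_mk_iff, Localization.r_iff_exists]
  refine ⟨1, ?_⟩
  simp only [OneMemClass.coe_one, Submonoid.coe_mul, pow_one]
  ring

lemma coordinateRatio_cocycle (i k l : Fin (n + 1)) :
    (ProjectiveSpace n).presheaf.map (homOfLE (inf_le_left :
        Proj.basicOpen 𝒜[n] (MvPolynomial.X i) ⊓ Proj.basicOpen 𝒜[n] (MvPolynomial.X k) ≤ _)).op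
          (Proj.awayToSection 𝒜[n] (MvPolynomial.X i) (coordinateRatio i l)) =
      (ProjectiveSpace n).presheaf.map (homOfLE (inf_le_left :
        Proj.basicOpen 𝒜[n] (MvPolynomial.X i) ⊓ Proj.basicOpen 𝒜[n] (MvPolynomial.X k) ≤ _)).op
          (Proj.awayToSection 𝒜[n] (MvPolynomial.X i) (coordinateRatio i k)) *
      (ProjectiveSpace n).presheaf.map (homOfLE (inf_le_right :
        Proj.basicOpen 𝒜[n] (MvPolynomial.X i) ⊓ Proj.basicOpen 𝒜[n] (MvPolynomial.X k) ≤ _)).op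
          (Proj.awayToSection 𝒜[n] (MvPolynomial.X k) (coordinateRatio k l)) := by
  have hmul := Proj.basicOpen_mul 𝒜[n] (MvPolynomial.X i) (MvPolynomial.X k)
  -- The basic open of `X_i X_k` equals the intersection only propositionally, so the identity is
  -- proved for a variable open `V`.
  have key : ∀ (V : (ProjectiveSpace n).Opens)
      (hV : Proj.basicOpen 𝒜[n] (MvPolynomial.X i * MvPolynomial.X k) = V)
      (hi : V ≤ Proj.basicOpen 𝒜[n] (MvPolynomial.X i))
      (hk : V ≤ Proj.basicOpen 𝒜[n] (MvPolynomial.X k)),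
      (ProjectiveSpace n).presheaf.map (homOfLE hi).op
          (Proj.awayToSection 𝒜[n] (MvPolynomial.X i) (coordinateRatio i l)) =
      (ProjectiveSpace n).presheaf.map (homOfLE hi).op
          (Proj.awayToSection 𝒜[n] (MvPolynomial.X i) (coordinateRatio i k)) *
      (ProjectiveSpace n).presheaf.map (homOfLE hk).op
          (Proj.awayToSection 𝒜[n] (MvPolynomial.X k) (coordinateRatio k l)) := by
    rintro _ rfl hi hk
    have h := congrArg (Proj.awayToSection 𝒜[n] (MvPolynomial.X i * MvPolynomial.X k))
      (awayMap_coordinateRatio i k l)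
    have h1 := fun a => congrArg (fun g => g.hom a) (Proj.awayMap_awayToSection 𝒜[n]
      (f := MvPolynomial.X i) (X_mem k) rfl)
    have h2 := fun a => congrArg (fun g => g.hom a) (Proj.awayMap_awayToSection 𝒜[n]
      (f := MvPolynomial.X k) (X_mem i) (mul_comm (MvPolynomial.X i) (MvPolynomial.X k)))
    rw [map_mul] at h
    exact (h1 _).symm.trans (h.trans (congrArg₂ _ (h1 _) (h2 _)))
  exact key _ hmul _ _

lemma adjoin_X_eq_top :
    Algebra.adjoin (𝒜[n] 0) (Set.range (MvPolynomial.X (R := ℂ) (σ := Fin (n + 1)))) = ⊤ := by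
  refine top_le_iff.1 fun P _ => ?_
  induction P using MvPolynomial.induction_on with
  | C c =>
    exact Subalgebra.algebraMap_mem (Algebra.adjoin (𝒜[n] 0) (Set.range MvPolynomial.X))
      (⟨MvPolynomial.C c, MvPolynomial.isHomogeneous_C _ c⟩ : 𝒜[n] 0)
  | add P Q hP hQ => exact add_mem (hP trivial) (hQ trivial)
  | mul_X P i hP => exact mul_mem (hP trivial) (Algebra.subset_adjoin ⟨i, rfl⟩)

lemma surjective_aeval_awayToSection (i : Fin (n + 1)) :
    letI := sectionsAlgebra (ProjectiveSpace.toSpecC n) (Proj.basicOpen 𝒜[n] (MvPolynomial.X i))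
    Function.Surjective (MvPolynomial.aeval (R := ℂ) fun k =>
      Proj.awayToSection 𝒜[n] (MvPolynomial.X i) (coordinateRatio i k)) := by
  let := sectionsAlgebra (ProjectiveSpace.toSpecC n) (Proj.basicOpen 𝒜[n] (MvPolynomial.X i))
  intro b
  obtain ⟨a, rfl⟩ := (Proj.basicOpenIsoAway 𝒜[n] (MvPolynomial.X i) (X_mem i)
    Nat.one_pos).commRingCatIsoToRingEquiv.surjective b
  obtain ⟨P, rfl⟩ := surjective_eval₂_coordinateRatio i a
  refine ⟨P, ?_⟩
  have hC : algebraMap ℂ Γ(ProjectiveSpace n, Proj.basicOpen 𝒜[n] (MvPolynomial.X i)) =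
      (Proj.awayToSection 𝒜[n] (MvPolynomial.X i)).hom.comp (awayConstants i) :=
    RingHom.ext (awayToSection_awayConstants i)
  rw [MvPolynomial.aeval_def, hC]
  exact (MvPolynomial.hom_eval₂ P _ (Proj.awayToSection 𝒜[n] (MvPolynomial.X i)).hom _).symm

/-- The standard charts of projective space. -/
def projectiveCharts (n : ℕ) : StandardCharts (ProjectiveSpace.toSpecC n) (Fin (n + 1)) where
  U i := Proj.basicOpen 𝒜[n] (MvPolynomial.X i)
  isAffineOpen := isAffineOpen_basicOpen_X
  cover x := by
    have h : ⨆ i, Proj.basicOpen 𝒜[n] (MvPolynomial.X i) = ⊤ := by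
      refine Proj.iSup_basicOpen_eq_top' 𝒜[n] _ (fun i => ⟨1, X_mem i⟩) ?_
      exact adjoin_X_eq_top
    have hx : x ∈ ⨆ i, Proj.basicOpen 𝒜[n] (MvPolynomial.X i) := h ▸ trivial
    exact TopologicalSpace.Opens.mem_iSup.1 hx
  y i k := Proj.awayToSection 𝒜[n] (MvPolynomial.X i) (coordinateRatio i k)
  surjective := surjective_aeval_awayToSection
  basicOpen_eq := basicOpen_awayToSection
  self i := by rw [coordinateRatio_self, map_one]
  cocycle := coordinateRatio_cocycle

variable {X : Scheme.{0}} {p : X ⟶ SpecC}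

theorem IsProjective.compactSpace (hp : IsProjective p) : CompactSpace (Pts p) := by
  obtain ⟨n, j, hj, rfl⟩ := hp
  exact ((projectiveCharts n).pullback j).compactSpace

theorem IsProjective.t2Space (hp : IsProjective p) : T2Space (Pts p) := by
  obtain ⟨n, j, hj, rfl⟩ := hp
  exact ((projectiveCharts n).pullback j).t2Space

end ProjectiveCharts

/-! ### Local equations of a linear pencil -/

section PencilCharts

variable {X : Scheme.{0}} (p : X ⟶ SpecC)

lemma res_algebraMap {U V : X.Opens} (h : V ≤ U) (c : ℂ) :
    letI := sectionsAlgebra p U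
    letI := sectionsAlgebra p V
    X.presheaf.map (homOfLE h).op (algebraMap ℂ Γ(X, U) c) = algebraMap ℂ Γ(X, V) c :=
  congrArg (fun g => g.hom ((Scheme.ΓSpecIso (CommRingCat.of ℂ)).inv c))
    (p.appLE_map (le_preimage_top p U) (homOfLE h).op)

/-- Restriction of sections as an algebra homomorphism. -/
def resAlgHom {U V : X.Opens} (h : V ≤ U) :
    letI := sectionsAlgebra p U
    letI := sectionsAlgebra p V
    Γ(X, U) →ₐ[ℂ] Γ(X, V) :=
  letI := sectionsAlgebra p U
  letI := sectionsAlgebra p V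
  { (X.presheaf.map (homOfLE h).op).hom with commutes' := res_algebraMap p h }

lemma resAlgHom_apply {U V : X.Opens} (h : V ≤ U) (a : Γ(X, U)) :
    letI := sectionsAlgebra p U
    letI := sectionsAlgebra p V
    resAlgHom p h a = X.presheaf.map (homOfLE h).op a := rfl

lemma isStandardSmooth_basicOpen {U : X.Opens} (hU : IsAffineOpen U) (s : Γ(X, U))
    (h : letI := sectionsAlgebra p U; Algebra.IsStandardSmooth ℂ Γ(X, U)) :
    letI := sectionsAlgebra p (X.basicOpen s)
    Algebra.IsStandardSmooth ℂ Γ(X, X.basicOpen s) := by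
  let := sectionsAlgebra p U
  let := sectionsAlgebra p (X.basicOpen s)
  have hloc : IsLocalization.Away s Γ(X, X.basicOpen s) := hU.isLocalization_basicOpen s
  have h1 : Algebra.IsStandardSmooth Γ(X, U) Γ(X, X.basicOpen s) :=
    Algebra.IsStandardSmooth.localization_away s
  have : IsScalarTower ℂ Γ(X, U) Γ(X, X.basicOpen s) :=
    IsScalarTower.of_algebraMap_eq fun c => (res_algebraMap p (X.basicOpen_le s) c).symm
  exact Algebra.IsStandardSmooth.trans ℂ Γ(X, U) Γ(X, X.basicOpen s)

lemma exists_isStandardSmooth [Smooth p] (x : X) :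
    ∃ V : X.affineOpens, x ∈ V.1 ∧
      (letI := sectionsAlgebra p V.1; Algebra.IsStandardSmooth ℂ Γ(X, V.1)) := by
  obtain ⟨U, hU, V, hV, hx, e, h⟩ := Smooth.exists_isStandardSmooth p x
  refine ⟨⟨V, hV⟩, hx, ?_⟩
  obtain rfl : U = ⊤ := by
    refine top_le_iff.1 fun z _ => ?_
    have : z = p x := Subsingleton.elim (α := PrimeSpectrum ℂ) _ _
    rw [this]
    exact e hx
  exact RingHom.isStandardSmooth_respectsIso.2 _
    (Scheme.ΓSpecIso (CommRingCat.of ℂ)).symm.commRingCatIsoToRingEquiv h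

variable {p}

/-- A dual number is a unit as soon as its constant term is, so tangent vectors extend to a
localization in which their base point lies. -/
lemma exists_tangent_lift_of_isLocalization {A B : Type} [CommRing A] [Algebra ℂ A] [CommRing B]
    [Algebra A B] (s : A) [IsLocalization.Away s B] (φ : A →ₐ[ℂ] ℂ) (φ' : B →+* ℂ)
    (hφ : ∀ a, φ' (algebraMap A B a) = φ a) (ψ : A →ₐ[ℂ] DualNumber ℂ) (hψ : IsTangentAt φ ψ) :
    ∃ χ : B →+* DualNumber ℂ, (∀ a, χ (algebraMap A B a) = ψ a) ∧ ∀ b, (χ b).fst = φ' b := by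
  have hs : IsUnit ((ψ : A →+* DualNumber ℂ) s) := by
    rw [RingHom.coe_coe, TrivSqZeroExt.isUnit_iff_isUnit_fst, hψ s, ← hφ]
    exact (IsLocalization.Away.algebraMap_isUnit s).map φ'
  have hlift : ∀ a, IsLocalization.Away.lift s hs (algebraMap A B a) = ψ a :=
    fun a => IsLocalization.Away.lift_eq s hs a
  refine ⟨IsLocalization.Away.lift s hs, hlift, fun b => ?_⟩
  have : (TrivSqZeroExt.fstHom ℂ ℂ ℂ : DualNumber ℂ →+* ℂ).comp
      (IsLocalization.Away.lift s hs) = φ' := by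
    refine IsLocalization.ringHom_ext (Submonoid.powers s) (RingHom.ext fun a => ?_)
    refine (congrArg TrivSqZeroExt.fst (hlift a)).trans ?_
    exact (hψ a).trans (hφ a).symm
  exact congrArg (fun g => g b) this

lemma exists_tangent_lift {U V : X.Opens} (hU : IsAffineOpen U) (s : Γ(X, U))
    (hV : V = X.basicOpen s) (hVU : V ≤ U) (x : Pts p) (hx : x.pt ∈ V) :
    letI := sectionsAlgebra p U
    ∀ ψ : Γ(X, U) →ₐ[ℂ] DualNumber ℂ, IsTangentAt (x.evalAlgHom (hVU hx)) ψ →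
      ∃ χ : Γ(X, V) →+* DualNumber ℂ, (∀ a, χ (X.presheaf.map (homOfLE hVU).op a) = ψ a) ∧
        ∀ b, (χ b).fst = x.eval hx b := by
  let := sectionsAlgebra p U
  subst hV
  intro ψ hψ
  have hloc : IsLocalization.Away s Γ(X, X.basicOpen s) := hU.isLocalization_basicOpen s
  exact exists_tangent_lift_of_isLocalization s (x.evalAlgHom (hVU hx)) (x.eval hx)
    (fun a => x.eval_res hVU hx a) ψ hψ

lemma ideal_eq_span_res {D : X.IdealSheafData} {U V : X.affineOpens} (h : V.1 ≤ U.1)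
    {g : Γ(X, U.1)}
    (hg : D.ideal U = Ideal.span {g}) :
    D.ideal V = Ideal.span {X.presheaf.map (homOfLE h).op g} := by
  have hm := D.map_ideal (U := V) (V := U) h
  rw [← hm, hg, Ideal.map_span, Set.image_singleton]
  rfl

lemma exists_common_basicOpen (U U' : X.affineOpens) {x : X} (hx : x ∈ U.1) (hx' : x ∈ U'.1) :
    ∃ V : X.affineOpens, V.1 ≤ U.1 ∧ V.1 ≤ U'.1 ∧ x ∈ V.1 ∧
      ∃ s : Γ(X, U'.1), V.1 = X.basicOpen s := by
  obtain ⟨s, s', hss, hxs⟩ := exists_basicOpen_le_affine_inter U.2 U'.2 x ⟨hx, hx'⟩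
  exact ⟨X.affineBasicOpen s, X.basicOpen_le s, hss.trans_le (X.basicOpen_le s'), hxs, s', hss⟩

lemma exists_isStandardSmooth_le (p : X ⟶ SpecC) [Smooth p] (U : X.affineOpens) {x : X}
    (hx : x ∈ U.1) :
    ∃ V : X.affineOpens, V.1 ≤ U.1 ∧ x ∈ V.1 ∧
      (letI := sectionsAlgebra p V.1; Algebra.IsStandardSmooth ℂ Γ(X, V.1)) := by
  obtain ⟨V, hxV, hV⟩ := exists_isStandardSmooth p x
  obtain ⟨⟨W, hW⟩, hWU, hWV, hxW, s, rfl⟩ := exists_common_basicOpen U V hx hxV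
  exact ⟨⟨_, hW⟩, hWU, hxW, isStandardSmooth_basicOpen p V.2 s hV⟩

variable (p) [IsIntegral X] (D₀ D₁ : X.IdealSheafData) (f : X.functionField)

/-- An affine open that is standard smooth over `ℂ`, with local equations of two divisors whose
quotient is the rational function `f`. -/
structure PencilChart where
  /-- The affine open. -/
  U : X.affineOpens
  nonempty : Nonempty U.1
  /-- The local equation of the first divisor. -/
  g₀ : Γ(X, U.1)
  /-- The local equation of the second divisor. -/
  g₁ : Γ(X, U.1)
  ideal₀ : D₀.ideal U = Ideal.span {g₀}
  ideal₁ : D₁.ideal U = Ideal.span {g₁}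
  rel : X.germToFunctionField U.1 g₀ = f * X.germToFunctionField U.1 g₁
  isStandardSmooth : letI := sectionsAlgebra p U.1; Algebra.IsStandardSmooth ℂ Γ(X, U.1)

variable {D₀ D₁ f}

lemma germToFunctionField_res {U V : X.Opens} [Nonempty U] [Nonempty V] (h : V ≤ U)
    (a : Γ(X, U)) : X.germToFunctionField V (X.presheaf.map (homOfLE h).op a) =
      X.germToFunctionField U a :=
  X.presheaf.germ_res_apply (homOfLE h) _ _ a

lemma exists_pencilChart [Smooth p]
    (hf : ∀ x : X, ∃ (U : X.affineOpens) (hx : x ∈ U.1) (g₀ g₁ : Γ(X, U.1)),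
      D₀.ideal U = Ideal.span {g₀} ∧ D₁.ideal U = Ideal.span {g₁} ∧
      haveI : Nonempty U.1 := ⟨⟨x, hx⟩⟩
      X.germToFunctionField U.1 g₀ = f * X.germToFunctionField U.1 g₁) (x : X) :
    ∃ C : PencilChart p D₀ D₁ f, x ∈ C.U.1 := by
  obtain ⟨U, hxU, g₀, g₁, h₀, h₁, hrel⟩ := hf x
  obtain ⟨V, hle, hxV, hV⟩ := exists_isStandardSmooth_le p U hxU
  have : Nonempty U.1 := ⟨⟨x, hxU⟩⟩
  have hne : Nonempty V.1 := ⟨⟨x, hxV⟩⟩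
  have hrel' : X.germToFunctionField V.1 (X.presheaf.map (homOfLE hle).op g₀) =
      f * X.germToFunctionField V.1 (X.presheaf.map (homOfLE hle).op g₁) := by
    rw [germToFunctionField_res hle, germToFunctionField_res hle]
    exact hrel
  exact ⟨⟨V, hne, _, _, ideal_eq_span_res hle h₀, ideal_eq_span_res hle h₁, hrel', hV⟩, hxV⟩

lemma res_ne_zero {U V : X.Opens} [Nonempty V] (h : V ≤ U) {g : Γ(X, U)} (hg : g ≠ 0) :
    X.presheaf.map (homOfLE h).op g ≠ 0 := by
  intro h0
  have := map_injective_of_isIntegral X (homOfLE h)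
  exact hg (this (h0.trans (map_zero _).symm))

/-- `IsHypersurface` provides some nonzero generator near each point. Any other generator is
associated to it on a common smaller open, where restriction is injective as `X` is integral. -/
lemma IsHypersurface.ne_zero {D : X.IdealSheafData} (hD : IsHypersurface D) {U : X.affineOpens}
    (hU : Nonempty U.1) {g : Γ(X, U.1)} (hg : D.ideal U = Ideal.span {g}) : g ≠ 0 := by
  obtain ⟨x, hx⟩ := hU
  obtain ⟨U', hx', g', hg', hD'⟩ := hD x
  obtain ⟨V, hle, hle', hxV, -⟩ := exists_common_basicOpen U U' hx hx'
  have : Nonempty V.1 := ⟨⟨x, hxV⟩⟩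
  rintro rfl
  have h1 := (ideal_eq_span_res hle hg).symm.trans (ideal_eq_span_res hle' hD')
  rw [map_zero, Ideal.span_singleton_eq_span_singleton, Associated.comm, associated_zero_iff_eq_zero]
    at h1
  exact res_ne_zero hle' hg' h1

namespace PencilChart

variable {p} (C C' : PencilChart p D₀ D₁ f)

lemma isAffineOpen : IsAffineOpen C.U.1 := C.U.2

/-- The local equation of a member of the pencil. -/
def g (t : ℂ) : Γ(X, C.U.1) :=
  letI := sectionsAlgebra p C.U.1
  pencil C.g₀ C.g₁ t

lemma g_zero : C.g 0 = C.g₀ := by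
  let := sectionsAlgebra p C.U.1
  simp [g, pencil]

lemma g_one : C.g 1 = C.g₁ := by
  let := sectionsAlgebra p C.U.1
  simp [g, pencil]

/-- Local equations in two charts differ by a unit that does not depend on the member of the
pencil. -/
lemma exists_unit_mul (hf : f ≠ 0) {x : X} (hx : x ∈ C.U.1)
    (hx' : x ∈ C'.U.1) :
    ∃ (V : X.Opens) (h : V ≤ C.U.1) (h' : V ≤ C'.U.1) (s : Γ(X, C'.U.1)) (u : Γ(X, V)),
      V = X.basicOpen s ∧ x ∈ V ∧ IsUnit u ∧
      ∀ t, X.presheaf.map (homOfLE h').op (C'.g t) = u * X.presheaf.map (homOfLE h).op (C.g t) := by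
  obtain ⟨V, hle, hle', hxV, s, hs⟩ := exists_common_basicOpen C.U C'.U hx hx'
  have hne : Nonempty V.1 := ⟨⟨x, hxV⟩⟩
  have := C.nonempty
  have := C'.nonempty
  have h₀ := (ideal_eq_span_res hle C.ideal₀).symm.trans (ideal_eq_span_res hle' C'.ideal₀)
  rw [Ideal.span_singleton_eq_span_singleton] at h₀
  obtain ⟨u, hu⟩ := h₀
  refine ⟨V.1, hle, hle', s, u.1, hs, hxV, u.isUnit, ?_⟩
  -- The unit `u` comes from the equations of `D₀`. Then `f g₁' = g₀' = u g₀ = u f g₁`, and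
  -- cancelling `f` shows that the same unit works for `D₁`.
  have h₁ : X.presheaf.map (homOfLE hle').op C'.g₁ =
      u.1 * X.presheaf.map (homOfLE hle).op C.g₁ := by
    apply X.germToFunctionField_injective V.1
    apply mul_left_cancel₀ hf
    have h2 := congrArg (X.germToFunctionField V.1) hu
    rw [map_mul, germToFunctionField_res hle, germToFunctionField_res hle', C.rel, C'.rel] at h2
    rw [map_mul, germToFunctionField_res hle, germToFunctionField_res hle', ← h2]
    ring
  intro t
  let := sectionsAlgebra p C.U.1
  let := sectionsAlgebra p C'.U.1
  let := sectionsAlgebra p V.1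
  change resAlgHom p hle' (pencil C'.g₀ C'.g₁ t) = u.1 * resAlgHom p hle (pencil C.g₀ C.g₁ t)
  rw [apply_pencil, apply_pencil]
  simp only [resAlgHom_apply]
  rw [h₁, ← hu]
  simp only [pencil, mul_add, mul_smul_comm, mul_comm]

lemma eval_eq_zero_of (hf : f ≠ 0) (x : Pts p) (h : x.pt ∈ C.U.1)
    (h' : x.pt ∈ C'.U.1) {t : ℂ} (h0 : x.eval h (C.g t) = 0) : x.eval h' (C'.g t) = 0 := by
  obtain ⟨V, hV, hV', s, u, -, hx, -, hu⟩ := C.exists_unit_mul C' hf h h'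
  have := congrArg (x.eval hx) (hu t)
  rw [map_mul, Pts.eval_res, Pts.eval_res, h0, mul_zero] at this
  exact this

/-- A tangent vector in the second chart extends to the common basic open and restricts from there
to the first chart; the two equations differ by a factor on the common open. -/
lemma isSingularAt_of (hf : f ≠ 0) (x : Pts p) (h : x.pt ∈ C.U.1)
    (h' : x.pt ∈ C'.U.1) {t : ℂ}
    (hs : letI := sectionsAlgebra p C.U.1; IsSingularAt (C.g t) (x.evalAlgHom h)) :
    letI := sectionsAlgebra p C'.U.1; IsSingularAt (C'.g t) (x.evalAlgHom h') := by
  let := sectionsAlgebra p C.U.1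
  let := sectionsAlgebra p C'.U.1
  obtain ⟨V, hV, hV', s, u, hVs, hx, -, hu⟩ := C.exists_unit_mul C' hf h h'
  let := sectionsAlgebra p V
  intro ψ hψ
  obtain ⟨χ, hχ, hχx⟩ := exists_tangent_lift C'.U.2 s hVs hV' x hx ψ hψ
  let ψ₀ : Γ(X, C.U.1) →ₐ[ℂ] DualNumber ℂ :=
    { χ.comp (X.presheaf.map (homOfLE hV).op).hom with
      commutes' := fun c => by
        change χ (X.presheaf.map (homOfLE hV).op (algebraMap ℂ Γ(X, C.U.1) c)) = _
        rw [res_algebraMap, ← res_algebraMap p hV', hχ, ψ.commutes] }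
  have hψ₀ : IsTangentAt (x.evalAlgHom h) ψ₀ := fun a =>
    (hχx _).trans (x.eval_res hV hx a)
  have h0 : χ (X.presheaf.map (homOfLE hV).op (C.g t)) = 0 := hs ψ₀ hψ₀
  rw [← hχ, hu, map_mul, h0, mul_zero]

end PencilChart

end PencilCharts

/-! ### Transport between the smooth members of a pencil -/

section Transport

open Topology Set

/-- Local retractions can be constructed in open charts. -/
lemma HasLocalRetraction.of_isOpenEmbedding {P Q : Type*} [TopologicalSpace P]
    [TopologicalSpace Q] {S : ℂ → Set P} {T : ℂ → Set Q} {e : Q → P} (he : IsOpenEmbedding e)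
    (hS : ∀ t y, e y ∈ S t ↔ y ∈ T t) {y₀ : Q} {t₀ : ℂ} (h : HasLocalRetraction T y₀ t₀) :
    HasLocalRetraction S (e y₀) t₀ := by
  obtain ⟨Ω, hΩ, h₀, r, hr, hrS⟩ := h
  have : Nonempty Q := ⟨y₀⟩
  let E := (he.prodMap (IsOpenEmbedding.id (X := ℂ))).toOpenPartialHomeomorph
  have hE : ∀ q : Q × ℂ, E.symm (e q.1, q.2) = q := fun q => E.left_inv (mem_univ q)
  refine ⟨Prod.map e id '' Ω, (he.prodMap IsOpenEmbedding.id).isOpenMap _ hΩ,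
    ⟨(y₀, t₀), h₀, rfl⟩, fun q => e (r (E.symm q)), ?_, ?_⟩
  · refine he.continuous.comp_continuousOn (hr.comp (E.continuousOn_symm.mono ?_) ?_)
    · rintro _ ⟨q, -, rfl⟩
      exact E.map_source (mem_univ q)
    · rintro _ ⟨q, hq, rfl⟩
      change E.symm (e q.1, q.2) ∈ Ω
      rwa [hE]
  · rintro _ ⟨q, hq, rfl⟩
    change e (r (E.symm (e q.1, q.2))) ∈ S q.2 ∧
      (e q.1 ∈ S q.2 → e (r (E.symm (e q.1, q.2))) = e q.1)
    rw [hE, hS, hS]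
    exact ⟨(hrS q hq).1, fun h => congrArg e ((hrS q hq).2 h)⟩

variable {X : Scheme.{0}} {p : X ⟶ SpecC}

lemma evalAlgHom_chartPoint {U : X.Opens} (hU : IsAffineOpen U) :
    letI := sectionsAlgebra p U
    ∀ φ : Γ(X, U) →ₐ[ℂ] ℂ, (chartPoint (p := p) hU φ).evalAlgHom (chartPoint_mem hU φ) = φ := by
  let := sectionsAlgebra p U
  exact fun φ => AlgHom.ext fun a => eval_chartPoint hU φ (chartPoint_mem hU φ) a

variable [IsIntegral X] {D₀ D₁ : X.IdealSheafData}
  {f : X.functionField}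

variable (p D₀ D₁ f) in
/-- The complex points of a member of the pencil. -/
def pencilMember (t : ℂ) : Set (Pts p) :=
  {x | ∀ (C : PencilChart p D₀ D₁ f) (h : x.pt ∈ C.U.1), x.eval h (C.g t) = 0}

variable (p D₀ D₁ f) in
/-- The pairs of a complex point and a member of the pencil that is singular at this point. -/
def singularLocus : Set (Pts p × ℂ) :=
  {q | ∀ (C : PencilChart p D₀ D₁ f) (h : q.1.pt ∈ C.U.1),
    letI := sectionsAlgebra p C.U.1
    IsSingularAt (C.g q.2) (q.1.evalAlgHom h)}

lemma mem_pencilMember_iff (hf : f ≠ 0) (C : PencilChart p D₀ D₁ f) (x : Pts p)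
    (h : x.pt ∈ C.U.1) (t : ℂ) : x ∈ pencilMember p D₀ D₁ f t ↔ x.eval h (C.g t) = 0 :=
  ⟨fun hx => hx C h, fun h0 C' h' => C.eval_eq_zero_of C' hf x h h' h0⟩

lemma mem_singularLocus_iff (hf : f ≠ 0) (C : PencilChart p D₀ D₁ f) (x : Pts p)
    (h : x.pt ∈ C.U.1) (t : ℂ) : (x, t) ∈ singularLocus p D₀ D₁ f ↔
      letI := sectionsAlgebra p C.U.1
      IsSingularAt (C.g t) (x.evalAlgHom h) :=
  ⟨fun hx => hx C h, fun h0 C' h' => C.isSingularAt_of C' hf x h h' h0⟩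

lemma chartPoint_mem_pencilMember_iff (hf : f ≠ 0) (C : PencilChart p D₀ D₁ f) (t : ℂ) :
    letI := sectionsAlgebra p C.U.1
    ∀ φ : Γ(X, C.U.1) →ₐ[ℂ] ℂ,
      chartPoint C.isAffineOpen φ ∈ pencilMember p D₀ D₁ f t ↔ φ (pencil C.g₀ C.g₁ t) = 0 := by
  let := sectionsAlgebra p C.U.1
  intro φ
  rw [mem_pencilMember_iff hf C _ (chartPoint_mem C.isAffineOpen φ), eval_chartPoint]
  rfl

lemma chartPoint_mem_singularLocus_iff (hf : f ≠ 0) (C : PencilChart p D₀ D₁ f) (t : ℂ) :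
    letI := sectionsAlgebra p C.U.1
    ∀ φ : Γ(X, C.U.1) →ₐ[ℂ] ℂ, (chartPoint C.isAffineOpen φ, t) ∈ singularLocus p D₀ D₁ f ↔
      IsSingularAt (pencil C.g₀ C.g₁ t) φ := by
  let := sectionsAlgebra p C.U.1
  intro φ
  rw [mem_singularLocus_iff hf C _ (chartPoint_mem C.isAffineOpen φ), evalAlgHom_chartPoint]
  rfl

/-- Closed subsets of `X(ℂ) × ℂ` can be recognized in charts. -/
lemma isClosed_of_charts (hcov : ∀ x : X, ∃ C : PencilChart p D₀ D₁ f, x ∈ C.U.1)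
    (W : Set (Pts p × ℂ))
    (hW : ∀ C : PencilChart p D₀ D₁ f, letI := sectionsAlgebra p C.U.1
      IsClosed {q : (Γ(X, C.U.1) →ₐ[ℂ] ℂ) × ℂ | (chartPoint (p := p) C.isAffineOpen q.1, q.2) ∈ W}) :
    IsClosed W := by
  rw [← isOpen_compl_iff, isOpen_iff_forall_mem_open]
  rintro ⟨x, t⟩ hx
  obtain ⟨C, hC⟩ := hcov x.pt
  let := sectionsAlgebra p C.U.1
  have he := (isOpenEmbedding_chartPoint (p := p) C.isAffineOpen).prodMap (IsOpenEmbedding.id (X := ℂ))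
  refine ⟨_, ?_, he.isOpenMap _ (hW C).isOpen_compl, (x.evalAlgHom hC, t), ?_, ?_⟩
  · rintro _ ⟨q, hq, rfl⟩
    exact hq
  · rw [mem_compl_iff, mem_ofPred_eq, chartPoint_evalAlgHom]
    exact hx
  · rw [Prod.map_apply, chartPoint_evalAlgHom]
    rfl

lemma isClosed_pencil (hf : f ≠ 0) (hcov : ∀ x : X, ∃ C : PencilChart p D₀ D₁ f, x ∈ C.U.1) :
    IsClosed {q : Pts p × ℂ | q.1 ∈ pencilMember p D₀ D₁ f q.2} := by
  refine isClosed_of_charts hcov _ fun C => ?_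
  let := sectionsAlgebra p C.U.1
  simp only [mem_ofPred_eq, chartPoint_mem_pencilMember_iff hf]
  exact isClosed_eq (continuous_pencil_apply C.g₀ C.g₁) continuous_const

lemma isClosed_singularLocus (hf : f ≠ 0)
    (hcov : ∀ x : X, ∃ C : PencilChart p D₀ D₁ f, x ∈ C.U.1) :
    IsClosed (singularLocus p D₀ D₁ f) := by
  refine isClosed_of_charts hcov _ fun C => ?_
  let := sectionsAlgebra p C.U.1
  have := C.isStandardSmooth
  simp only [chartPoint_mem_singularLocus_iff hf]
  exact isClosed_isSingularAt C.g₀ C.g₁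

lemma hasLocalRetraction_pencilMember (hf : f ≠ 0)
    (hcov : ∀ x : X, ∃ C : PencilChart p D₀ D₁ f, x ∈ C.U.1) {x : Pts p} {t : ℂ}
    (hx : x ∈ pencilMember p D₀ D₁ f t) (hns : (x, t) ∉ singularLocus p D₀ D₁ f) :
    HasLocalRetraction (pencilMember p D₀ D₁ f) x t := by
  obtain ⟨C, hC⟩ := hcov x.pt
  let := sectionsAlgebra p C.U.1
  obtain ⟨ι, σ, _, _, ⟨P⟩⟩ := C.isStandardSmooth
  rw [← chartPoint_evalAlgHom C.isAffineOpen x hC] at hx hns ⊢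
  rw [chartPoint_mem_pencilMember_iff hf] at hx
  rw [chartPoint_mem_singularLocus_iff hf] at hns
  exact HasLocalRetraction.of_isOpenEmbedding (isOpenEmbedding_chartPoint C.isAffineOpen)
    (chartPoint_mem_pencilMember_iff hf C) (exists_pencil_retraction P C.g₀ C.g₁ hx hns)

lemma notMem_singularLocus_zero (hf : f ≠ 0)
    (hcov : ∀ x : X, ∃ C : PencilChart p D₀ D₁ f, x ∈ C.U.1) (hD₀ : IsHypersurface D₀)
    (hs : Smooth (D₀.subschemeι ≫ p)) (x : Pts p) : (x, 0) ∉ singularLocus p D₀ D₁ f := by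
  obtain ⟨C, hC⟩ := hcov x.pt
  let := sectionsAlgebra p C.U.1
  have := C.nonempty
  rw [mem_singularLocus_iff hf C x hC]
  have h := formallySmooth_quotient D₀ hs C.U
  rw [C.ideal₀] at h
  have h2 := not_isSingularAt_of_formallySmooth (hD₀.ne_zero C.nonempty C.ideal₀)
    (x.evalAlgHom hC)
  rwa [C.g_zero]

lemma notMem_singularLocus_one (hf : f ≠ 0)
    (hcov : ∀ x : X, ∃ C : PencilChart p D₀ D₁ f, x ∈ C.U.1) (hD₁ : IsHypersurface D₁)
    (hs : Smooth (D₁.subschemeι ≫ p)) (x : Pts p) : (x, 1) ∉ singularLocus p D₀ D₁ f := by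
  obtain ⟨C, hC⟩ := hcov x.pt
  let := sectionsAlgebra p C.U.1
  have := C.nonempty
  rw [mem_singularLocus_iff hf C x hC]
  have h := formallySmooth_quotient D₁ hs C.U
  rw [C.ideal₁] at h
  have h2 := not_isSingularAt_of_formallySmooth (hD₁.ne_zero C.nonempty C.ideal₁)
    (x.evalAlgHom hC)
  rwa [C.g_one]

/-- Only finitely many members of the pencil are singular. -/
theorem finite_singularValues [CompactSpace (Pts p)] (hf : f ≠ 0)
    (hcov : ∀ x : X, ∃ C : PencilChart p D₀ D₁ f, x ∈ C.U.1)
    (h₀ : ∀ x, (x, 0) ∉ singularLocus p D₀ D₁ f) :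
    {t | ∃ x, (x, t) ∈ singularLocus p D₀ D₁ f}.Finite := by
  set T := {t | ∃ x, (x, t) ∈ singularLocus p D₀ D₁ f} with hT
  have hTc : IsClosed T := by
    have h := isClosedMap_snd_of_compactSpace _ (isClosed_singularLocus hf hcov)
    convert h using 1
    ext t
    simp [hT]
  have h0T : (0 : ℂ) ∉ T := fun ⟨x, hx⟩ => h₀ x hx
  -- Closedness of `T` serves to exclude the cofinite alternative in every chart.
  have hTinf : Tᶜ.Infinite := infinite_of_mem_nhds 0 (hTc.isOpen_compl.mem_nhds h0T)
  have hchart : ∀ C : PencilChart p D₀ D₁ f,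
      {t | ∃ x : Pts p, x.pt ∈ C.U.1 ∧ (x, t) ∈ singularLocus p D₀ D₁ f}.Finite := by
    intro C
    let := sectionsAlgebra p C.U.1
    have := C.isStandardSmooth
    have heq : {t | ∃ x : Pts p, x.pt ∈ C.U.1 ∧ (x, t) ∈ singularLocus p D₀ D₁ f} =
        {t | ∃ φ : Γ(X, C.U.1) →ₐ[ℂ] ℂ, IsSingularAt (pencil C.g₀ C.g₁ t) φ} := by
      ext t
      constructor
      · rintro ⟨x, hx, h⟩
        exact ⟨_, (mem_singularLocus_iff hf C x hx t).1 h⟩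
      · rintro ⟨φ, hφ⟩
        exact ⟨_, chartPoint_mem C.isAffineOpen φ, (chartPoint_mem_singularLocus_iff hf C t φ).2 hφ⟩
    rcases finite_or_finite_compl_singularValues C.g₀ C.g₁ with h | h
    · rwa [heq]
    · refine absurd (h.subset (compl_subset_compl.2 ?_)) hTinf
      rw [← heq]
      rintro t ⟨x, -, hx⟩
      exact ⟨x, hx⟩
  obtain ⟨F, hF⟩ := isCompact_univ.elim_finite_subcover
    (fun C : PencilChart p D₀ D₁ f => {x : Pts p | x.pt ∈ C.U.1}) (fun C => Pts.isOpen_mem C.U.1)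
    fun x _ => by
      obtain ⟨C, hC⟩ := hcov x.pt
      exact mem_iUnion.2 ⟨C, hC⟩
  refine (F.finite_toSet.biUnion fun C _ => hchart C).subset ?_
  rintro t ⟨x, hx⟩
  obtain ⟨C, hCF, hC⟩ := mem_iUnion₂.1 (hF (mem_univ x))
  exact mem_biUnion hCF ⟨x, hC, hx⟩

/-- The smooth members of a pencil can be mapped continuously to each other, with the base locus
fixed. -/
theorem hasTransport_pencilMember [CompactSpace (Pts p)] [T2Space (Pts p)] (hf : f ≠ 0)
    (hcov : ∀ x : X, ∃ C : PencilChart p D₀ D₁ f, x ∈ C.U.1)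
    (h₀ : ∀ x, (x, 0) ∉ singularLocus p D₀ D₁ f) {s t : ℂ}
    (hs : ∀ x, (x, s) ∉ singularLocus p D₀ D₁ f) (ht : ∀ x, (x, t) ∉ singularLocus p D₀ D₁ f) :
    HasTransport (pencilMember p D₀ D₁ f) (⋂ t, pencilMember p D₀ D₁ f t) s t := by
  have hfin := finite_singularValues hf hcov h₀
  -- A countable set does not disconnect a real vector space of dimension greater than one.
  have hconn : IsConnected {t | ∃ x, (x, t) ∈ singularLocus p D₀ D₁ f}ᶜ :=
    hfin.countable.isConnected_compl_of_one_lt_rank (by simp)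
  refine hasTransport_of_isPreconnected (isClosed_pencil hf hcov) hconn.isPreconnected
    (fun u hu x hx => hasLocalRetraction_pencilMember hf hcov hx fun h => hu ⟨x, h⟩)
    (fun ⟨x, h⟩ => hs x h) (fun ⟨x, h⟩ => ht x h)

end Transport

/-! ### Comparison of the restriction maps -/

section Restriction

open Topology Set

variable {X : Scheme.{0}} {p : X ⟶ SpecC}

lemma push_map_inclusionOver {D Z : X.IdealSheafData} (h : D ≤ Z) (z : Pts (Z.subschemeι ≫ p)) :
    Pts.push (p := p) D.subschemeι (Points.map (inclusionOver p h) z) =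
      Pts.push (p := p) Z.subschemeι z := by
  refine Pts.ext ?_
  change (z.hom ≫ Scheme.IdealSheafData.inclusion h) ≫ D.subschemeι = z.hom ≫ Z.subschemeι
  rw [Category.assoc, Scheme.IdealSheafData.inclusion_subschemeι]

/-- A continuous map between the complex points of two closed subschemes that fixes the points of
a common closed subscheme compares the images of the restriction maps. -/
lemma range_restriction_le {D D' Z : X.IdealSheafData} (h : D ≤ Z) (h' : D' ≤ Z)
    (Φ : C(Points (subschemeOver p D), Points (subschemeOver p D')))
    (hΦ : ∀ z : Points (subschemeOver p Z),
      Φ (Points.map (inclusionOver p h) z) = Points.map (inclusionOver p h') z) (i : ℤ) :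
    LinearMap.range (restriction p h' i) ≤ LinearMap.range (restriction p h i) := by
  obtain ⟨Ψ, hΨ⟩ : ∃ Ψ : pointsFunctor.obj (subschemeOver p D) ⟶
      pointsFunctor.obj (subschemeOver p D'), pointsFunctor.map (inclusionOver p h') =
        pointsFunctor.map (inclusionOver p h) ≫ Ψ := by
    refine ⟨TopCat.ofHom Φ, ?_⟩
    ext z
    exact (hΦ z).symm
  have hcoh : (cohomology i).map (inclusionOver p h').op =
      (singularCohomologyFunctor i).map Ψ.op ≫ (cohomology i).map (inclusionOver p h).op := by
    change (singularCohomologyFunctor i).map (pointsFunctor.map (inclusionOver p h')).op =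
      _ ≫ (singularCohomologyFunctor i).map (pointsFunctor.map (inclusionOver p h)).op
    rw [hΨ, op_comp, Functor.map_comp]
  rintro _ ⟨a, rfl⟩
  exact ⟨(singularCohomologyFunctor i).map Ψ.op a, (congrArg (fun g => g.hom a) hcoh).symm⟩

variable [IsIntegral X] {D₀ D₁ : X.IdealSheafData} {f : X.functionField}

lemma range_push_eq_pencilMember
    (hcov : ∀ x : X, ∃ C : PencilChart p D₀ D₁ f, x ∈ C.U.1) {D : X.IdealSheafData} {t : ℂ}
    (hD : ∀ C : PencilChart p D₀ D₁ f, D.ideal C.U = Ideal.span {C.g t}) :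
    range (Pts.push (p := p) D.subschemeι) = pencilMember p D₀ D₁ f t := by
  ext x
  constructor
  · rintro ⟨y, rfl⟩ C hC
    refine Pts.eval_eq_zero_of_push D y C.U hC ?_
    rw [hD C]
    exact Ideal.mem_span_singleton_self _
  · intro hx
    obtain ⟨C, hC⟩ := hcov x.pt
    obtain ⟨y, hy⟩ := Pts.exists_push_eq D x C.U hC fun a ha => by
      rw [hD C, Ideal.mem_span_singleton] at ha
      obtain ⟨b, rfl⟩ := ha
      rw [map_mul, hx C hC, zero_mul]
    exact ⟨y, hy⟩

lemma PencilChart.ideal_zero (C : PencilChart p D₀ D₁ f) :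
    D₀.ideal C.U = Ideal.span {C.g 0} := by
  rw [C.ideal₀, C.g_zero]

lemma PencilChart.ideal_one (C : PencilChart p D₀ D₁ f) :
    D₁.ideal C.U = Ideal.span {C.g 1} := by
  rw [C.ideal₁, C.g_one]

/-- Both `g₀` and `g₁` lie in the ideal of `Z`, so `Z` is in the base locus, which transport fixes.
-/
lemma push_mem_pencilMember {Z : X.IdealSheafData} (h₀ : D₀ ≤ Z) (h₁ : D₁ ≤ Z)
    (z : Pts (Z.subschemeι ≫ p)) (t : ℂ) :
    Pts.push (p := p) Z.subschemeι z ∈ pencilMember p D₀ D₁ f t := by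
  intro C hC
  refine Pts.eval_eq_zero_of_push Z z C.U hC ?_
  let := sectionsAlgebra p C.U.1
  have hg₀ : C.g₀ ∈ Z.ideal C.U := h₀ C.U (by rw [C.ideal₀]; exact Ideal.mem_span_singleton_self _)
  have hg₁ : C.g₁ ∈ Z.ideal C.U := h₁ C.U (by rw [C.ideal₁]; exact Ideal.mem_span_singleton_self _)
  change (1 - t) • C.g₀ + t • C.g₁ ∈ _
  rw [Algebra.smul_def, Algebra.smul_def]
  exact Ideal.add_mem _ (Ideal.mul_mem_left _ _ hg₀) (Ideal.mul_mem_left _ _ hg₁)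

/-- Transport in the pencil compares the restriction maps. -/
lemma range_restriction_le_of_hasTransport
    (hcov : ∀ x : X, ∃ C : PencilChart p D₀ D₁ f, x ∈ C.U.1) {D D' Z : X.IdealSheafData} {s t : ℂ}
    (hD : ∀ C : PencilChart p D₀ D₁ f, D.ideal C.U = Ideal.span {C.g s})
    (hD' : ∀ C : PencilChart p D₀ D₁ f, D'.ideal C.U = Ideal.span {C.g t})
    (h₀ : D₀ ≤ Z) (h₁ : D₁ ≤ Z) (h : D ≤ Z) (h' : D' ≤ Z)
    (hst : HasTransport (pencilMember p D₀ D₁ f) (⋂ t, pencilMember p D₀ D₁ f t) s t) (i : ℤ) :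
    LinearMap.range (restriction p h' i) ≤ LinearMap.range (restriction p h i) := by
  obtain ⟨φ, hφ, hφZ⟩ := hst
  have hmem : ∀ y : Pts (D.subschemeι ≫ p), y.push D.subschemeι ∈ pencilMember p D₀ D₁ f s :=
    fun y => (range_push_eq_pencilMember hcov hD).le (mem_range_self y)
  have hex : ∀ x : pencilMember p D₀ D₁ f t, ∃ y : Pts (D'.subschemeι ≫ p),
      y.push D'.subschemeι = x.1 := fun x =>
    (range_push_eq_pencilMember hcov hD').ge x.2
  choose ρ hρ using hex
  have hcont : Continuous fun y : Pts (D.subschemeι ≫ p) => ρ (φ ⟨y.push D.subschemeι, hmem y⟩) := by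
    -- The classical topology of `D'` is the subspace topology, so continuity can be tested in
    -- `X(ℂ)`, where the composite is the transport map.
    rw [(Pts.isEmbedding_push (p := p) D'.subschemeι).continuous_iff]
    refine (continuous_subtype_val.comp (hφ.comp
      ((Pts.continuous_push D.subschemeι).subtype_mk hmem))).congr fun y => ?_
    exact (hρ _).symm
  refine range_restriction_le h h' ⟨_, hcont⟩ (fun z => ?_) i
  apply (Pts.isEmbedding_push (p := p) D'.subschemeι).injective
  have hpush := push_map_inclusionOver (p := p) h z
  have hpush' := push_map_inclusionOver (p := p) h' z
  refine ((hρ _).trans (hφZ _ ?_)).trans (hpush.trans hpush'.symm)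
  exact mem_iInter.2 fun u =>
    hpush.symm.subst (motive := (· ∈ pencilMember p D₀ D₁ f u)) (push_mem_pencilMember h₀ h₁ z u)

end Restriction

end ComplexVariety

end

open ComplexVariety in
theorem mainTheorem6
    (X : Scheme.{0}) (p : X ⟶ SpecC) [IsIntegral X] [Smooth p] (hX : IsProjective p)
    (D₀ D₁ : X.IdealSheafData)
    (hD₀ : IsHypersurface D₀) (hD₁ : IsHypersurface D₁)
    (hD₀s : Smooth (D₀.subschemeι ≫ p)) (hD₁s : Smooth (D₁.subschemeι ≫ p))
    (hlin : LinearlyEquivalent D₀ D₁)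
    (Z : X.IdealSheafData) (hZs : Smooth (Z.subschemeι ≫ p))
    (hZ₀ : D₀ ≤ Z) (hZ₁ : D₁ ≤ Z) (i : ℤ) :
    LinearMap.range (restriction p hZ₀ i) = LinearMap.range (restriction p hZ₁ i) := by
  obtain ⟨f, hf, hlin⟩ := hlin
  have hcov := exists_pencilChart (p := p) hlin
  have := hX.compactSpace
  have := hX.t2Space
  have h₀ := notMem_singularLocus_zero hf hcov hD₀ hD₀s
  have h₁ := notMem_singularLocus_one hf hcov hD₁ hD₁s
  -- Transport from `D₁` to `D₀` gives the first inclusion, transport from `D₀` to `D₁` the second.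
  exact le_antisymm
    (range_restriction_le_of_hasTransport hcov PencilChart.ideal_one PencilChart.ideal_zero
      hZ₀ hZ₁ hZ₁ hZ₀ (hasTransport_pencilMember hf hcov h₀ h₁ h₀) i)
    (range_restriction_le_of_hasTransport hcov PencilChart.ideal_zero PencilChart.ideal_one
      hZ₀ hZ₁ hZ₀ hZ₁ (hasTransport_pencilMember hf hcov h₀ h₀ h₁) i)
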